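/- Throughout, rational functions are regarded as self-maps of $\mathbb{CP}^1=\mathbb C\cup\{\infty\}$. For an elliptic curve $\mathcal C$ over $\mathbb C$ with neutral element $O$ and a morphism $\pi:\mathcal C\to\mathbb{CP}^1$ of degree two with $\pi(-z)=\pi(z)$, a rational function $L$ with $L\circ\pi=\pi\circ[2]$ is called a Lattès map induced by multiplication by $2$ on $\mathcal C$. If $j$ is the $j$-invariant of $\mathcal C$, we say that $L$ is of the form $\mathcal L_j$. For a decomposition $L=U\circ V$ into rational functions, $V\circ U$ is called an elementary transformation of $L$. Two decompositions $U\circ V$ and $U'\circ V'$ are equivalent if $U'=U\circ\mu$, $V'=\mu^{-1}\circ V$ for some Möbius transformation $\mu$. Let $$\begin{aligned}\Phi_2(x,y)={}&-x^2y^2+x^3+y^3+2^4\cdot3\cdot31\,xy(x+y)+3^4\cdot5^3\cdot4027\,xy\\&-2^4\cdot3^4\cdot5^3(x^2+y^2)+2^8\cdot3^7\cdot5^6(x+y)-2^{12}\cdot3^9\cdot5^9\end{aligned}$$ be the classical modular polynomial of level $2$. **Corollary.** Let $j\in\mathbb C$, and let $\mathcal L=\mathcal L_j$ be the Lattès map induced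 by multiplication by $2$ on an elliptic curve $\mathcal C$ with $j$-invariant $j$, through the projection $\pi$. Then every elementary transformation of $\mathcal L$ is of the form $\mathcal L_{j'}$ with $j'=j$ or $\Phi_2(j,j')=0$. More precisely: 1. If $\mathcal L=U\circ V$ and one of $U,V$ is invertible, then $V\circ U$ is conjugate to $\mathcal L$ by a Möbius transformation, and is again of the form $\mathcal L_j$. 2. If $\mathcal L=U\circ V$ and neither $U$ nor $V$ is invertible (equivalently, both have degree greater than one), then there are a subgroup $\Gamma\subset\mathcal C$ of order two, an elliptic curve $\widetilde{\mathcal C}$ with $j$-invariant $j'$, an even morphism $\widetilde\pi:\widetilde{\mathcal C}\to\mathbb{CP}^1$ of degree two, an isogeny $\psi:\mathcal C\to\widetilde{\mathcal C}$ with kernel $\Gamma$, and its dual $\widehat\psi:\widetilde{\mathcal C}\to\mathcal C$ (so that $\widehat\psi\circ\psi=[2]$ and $\psi\circ\widehat\psi=[2]$), such that $$V\circ\pi=\widetilde\pi\circ\psi,\qquad U\circ\widetilde\pi=\pi\circ\widehat\psi .$$ Moreover $(V\circ U)\circ\widetilde\pi=\widetilde\pi\circ[2]$, so that $V\circ U$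 is of the form $\mathcal L_{j'}$, and $\Phi_2(j,j')=0$. 3. For every $j'\in\mathbb C$, one has $\Phi_2(j,j')=0$ if and only if there is a decomposition $\mathcal L=U\circ V$ into non-invertible rational functions for which $V\circ U$ is of the form $\mathcal L_{j'}$. 4. There are exactly three subgroups $\Gamma\subset\mathcal C$ of order two, each of them gives a decomposition of $\mathcal L$ into non-invertible factors as in 2, and two decompositions obtained as in 2 are equivalent if and only if they come from the same subgroup. Thus, up to equivalence, there are exactly three decompositions of $\mathcal L$ into non-invertible factors. -/

import Mathlib

noncomputable section

/-- Homogeneous coordinates of a point of the Riemann sphere `ℂ ∪ {∞} = ℂℙ¹`. -/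
def sphereCoord (z : OnePoint ℂ) : Fin 2 → ℂ :=
  z.elim ![1, 0] (fun t : ℂ => ![t, 1])

/-- Homogeneous coordinates in `ℂℙ²` of a point of a Weierstrass curve; the neutral element is
`[0 : 1 : 0]`. -/
def curveCoord (W : WeierstrassCurve ℂ) : W.toAffine.Point → Fin 3 → ℂ
  | .zero => ![0, 1, 0]
  | .some x y _ => ![x, y, 1]

/-- Morphisms between sets of points `X`, `Y` of projective varieties, given with homogeneous
coordinates `cX`, `cY`: near every point of `X`, the map is given by homogeneous polynomials of the
same degree without common zero. (The set of points where they do not all vanish is the Zariski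
neighbourhood on which the formula is required to hold.) -/
def IsMorphism {X Y : Type} {m n : ℕ} (cX : X → Fin m → ℂ) (cY : Y → Fin n → ℂ)
    (f : X → Y) : Prop :=
  ∀ P : X, ∃ (d : ℕ) (F : Fin n → MvPolynomial (Fin m) ℂ),
    (∀ i, (F i).IsHomogeneous d) ∧
    (∃ i, MvPolynomial.eval (cX P) (F i) ≠ 0) ∧
    ∀ Q : X, (∃ i, MvPolynomial.eval (cX Q) (F i) ≠ 0) →
      ∃ c : ℂ, cY (f Q) = fun i => c * MvPolynomial.eval (cX Q) (F i)

/-- Rational functions, as self-maps of the Riemann sphere: `f = F₀ / F₁` with homogeneous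
`F₀, F₁` of the same degree without common zero on `ℂℙ¹`. -/
def IsRationalMap (f : OnePoint ℂ → OnePoint ℂ) : Prop :=
  ∃ (d : ℕ) (F : Fin 2 → MvPolynomial (Fin 2) ℂ),
    (∀ i, (F i).IsHomogeneous d) ∧
    ∀ z : OnePoint ℂ, (∃ i, MvPolynomial.eval (sphereCoord z) (F i) ≠ 0) ∧
      ∃ c : ℂ, sphereCoord (f z) = fun i => c * MvPolynomial.eval (sphereCoord z) (F i)

/-- Möbius transformations: invertible rational functions. -/
def IsMobius (μ : OnePoint ℂ ≃ OnePoint ℂ) : Prop :=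
  IsRationalMap μ ∧ IsRationalMap μ.symm

/-- A rational function that is invertible with respect to composition. -/
def IsInvertibleMap (f : OnePoint ℂ → OnePoint ℂ) : Prop :=
  ∃ μ : OnePoint ℂ ≃ OnePoint ℂ, IsMobius μ ∧ f = μ

/-- Conjugate self-maps of the sphere. -/
def AreConjugate (A B : OnePoint ℂ → OnePoint ℂ) : Prop :=
  ∃ μ : OnePoint ℂ ≃ OnePoint ℂ, IsMobius μ ∧ B = μ.symm ∘ A ∘ μ

/-- `A = U ∘ V` is a decomposition of `A` into rational functions. The corresponding elementary
transformation of `A` is `V ∘ U`. -/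
structure IsDecomposition (A U V : OnePoint ℂ → OnePoint ℂ) : Prop where
  left : IsRationalMap U
  right : IsRationalMap V
  eq_comp : A = U ∘ V

/-- A decomposition none of whose two factors is invertible. For a nonconstant rational function
this says that both factors have degree greater than one. -/
structure IsNontrivialDecomposition (A U V : OnePoint ℂ → OnePoint ℂ) : Prop
    extends IsDecomposition A U V where
  left_not_invertible : ¬ IsInvertibleMap U
  right_not_invertible : ¬ IsInvertibleMap V

/-- Equivalence of the decompositions `U ∘ V` and `U' ∘ V'`. -/
def AreEquivalentDecompositions (U V U' V' : OnePoint ℂ → OnePoint ℂ) : Prop :=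
  ∃ μ : OnePoint ℂ ≃ OnePoint ℂ, IsMobius μ ∧ U' = U ∘ μ ∧ V' = μ.symm ∘ V

/-- The projections `π` from an elliptic curve to the sphere that are used for Lattès maps: even
morphisms of degree two. (The degree of a morphism of complex curves is the number of points in all
but finitely many of its fibres.) -/
structure IsEvenDoubleCover (W : WeierstrassCurve ℂ) (π : W.toAffine.Point → OnePoint ℂ) :
    Prop where
  morphism : IsMorphism (curveCoord W) sphereCoord π
  degree_two : {t : OnePoint ℂ | (π ⁻¹' {t}).ncard ≠ 2}.Finite
  even : ∀ P, π (-P) = π P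

/-- `L` is the Lattès map induced by multiplication by two on the elliptic curve `W`, through the
projection `π`, that is `L ∘ π = π ∘ [2]`. -/
structure IsLattesDoubling (W : WeierstrassCurve ℂ) (π : W.toAffine.Point → OnePoint ℂ)
    (L : OnePoint ℂ → OnePoint ℂ) : Prop where
  rational : IsRationalMap L
  cover : IsEvenDoubleCover W π
  comm : ∀ P, L (π P) = π (2 • P)

/-- `L` is of the form `𝓛_j`: a Lattès map induced by multiplication by two on some elliptic curve
with `j`-invariant `j`. -/
def IsLattesOfJ (j : ℂ) (L : OnePoint ℂ → OnePoint ℂ) : Prop :=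
  ∃ (W : WeierstrassCurve ℂ) (_ : W.IsElliptic) (π : W.toAffine.Point → OnePoint ℂ),
    W.j = j ∧ IsLattesDoubling W π L

/-- Isogenies: morphisms that preserve the neutral element. -/
structure IsIsogeny (W W' : WeierstrassCurve ℂ)
    (ψ : W.toAffine.Point → W'.toAffine.Point) : Prop where
  morphism : IsMorphism (curveCoord W) (curveCoord W') ψ
  map_zero : ψ 0 = 0

/-- The pair `(U, V)` is obtained from an isogeny `ψ : W → W'` with kernel `Γ` of order two and its
dual `ψ'`, through the projections `π` and `π'`:
`V ∘ π = π' ∘ ψ` and `U ∘ π' = π ∘ ψ'`. -/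
def IsTwoIsogenyPair (W W' : WeierstrassCurve ℂ) (π : W.toAffine.Point → OnePoint ℂ)
    (π' : W'.toAffine.Point → OnePoint ℂ) (Γ : AddSubgroup W.toAffine.Point)
    (U V : OnePoint ℂ → OnePoint ℂ) : Prop :=
  Nat.card Γ = 2 ∧
  ∃ (ψ : W.toAffine.Point → W'.toAffine.Point) (ψ' : W'.toAffine.Point → W.toAffine.Point),
    IsIsogeny W W' ψ ∧ IsIsogeny W' W ψ' ∧
    (∀ P, ψ P = 0 ↔ P ∈ Γ) ∧
    (∀ P, ψ' (ψ P) = 2 • P) ∧ (∀ P, ψ (ψ' P) = 2 • P) ∧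
    (∀ P, V (π P) = π' (ψ P)) ∧ (∀ P, U (π' P) = π (ψ' P))

/-- The pair `(U, V)` is a decomposition `U_Γ ∘ V_Γ` of `L` attached to the subgroup `Γ` of order
two of `W`, for some choice of the target curve and of its projection to the sphere. -/
def IsDecompositionOfSubgroup (W : WeierstrassCurve ℂ) (π : W.toAffine.Point → OnePoint ℂ)
    (L : OnePoint ℂ → OnePoint ℂ) (Γ : AddSubgroup W.toAffine.Point)
    (U V : OnePoint ℂ → OnePoint ℂ) : Prop :=
  IsDecomposition L U V ∧
  ∃ (W' : WeierstrassCurve ℂ) (_ : W'.IsElliptic) (π' : W'.toAffine.Point → OnePoint ℂ),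
    IsEvenDoubleCover W' π' ∧ IsTwoIsogenyPair W W' π π' Γ U V

/-- The classical modular polynomial `Φ₂`. -/
def modularPhiTwo (x y : ℂ) : ℂ :=
  -x ^ 2 * y ^ 2 + x ^ 3 + y ^ 3 + 2 ^ 4 * 3 * 31 * x * y * (x + y)
    + 3 ^ 4 * 5 ^ 3 * 4027 * x * y - 2 ^ 4 * 3 ^ 4 * 5 ^ 3 * (x ^ 2 + y ^ 2)
    + 2 ^ 8 * 3 ^ 7 * 5 ^ 6 * (x + y) - 2 ^ 12 * 3 ^ 9 * 5 ^ 9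

end

/-! The projection `π` is the quotient of the curve by `±1`, up to a Möbius transformation. Let `L =
U ∘ V`, and let `H` be the group of the points `T` with `2T = 0` and `V(π(P + T)) = V(π P)` for all
`P`. If `V(π Q) = V(π P)`, then `π(2Q) = π(2P)`, so `π Q = π(P + T)` for some 2-torsion point `T`.
Translation by `T` descends to a rational function, so for `T` outside `H` the relation `V(π(P + T))
= V(π P)` holds over finitely many points of the sphere only. Hence a general fibre of `V` is `π(P +
H)`, where the order of `H` divides 4. If it is 1, `V` is invertible; if it is 4, `U` is injective,
hence invertible. In a nontrivial decomposition `H = {0, T}` and `V` has degree two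
(`IsKummerMap.exists_translation_invariant`).

Move `T` to `(0, 0)` on a curve `y² = x³ + a x² + b x`. Translation by `T` becomes `z ↦ b / z`, and
a function of degree two invariant under it is a Möbius transformation of `z + a + b / z`
(`exists_mobius_comp_isogX`), which is the `x`-coordinate of the explicit isogeny with kernel `{O,
(0, 0)}`. Since `V` is surjective, `U` is forced by `L = U ∘ V` and comes from the dual isogeny
(`IsLattesDoubling.exists_eq_isogX`). So nontrivial decompositions up to equivalence correspond to
points of order two; the subgroup is recovered from `V` as the set of `P` with `V(π P) = V(π 0)`.

If the points of order two have abscissas `0`, `r`, `s`, the polynomial `Φ₂(j, Y)` splits into three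
linear factors, whose roots are the invariants of the three quotients (`modularPhiTwo_eq`). To read
`j'` off from `V ∘ U` alone, one needs that a Lattès map determines its `j`-invariant: the values
with fewer than four preimages are the images of the points of order two, all of them are mapped to
`π 0`, and these four points determine `j` (`IsLattesDoubling.j_eq`). -/

noncomputable section

open Polynomial

/-! ### Rational functions as pairs of coprime polynomials: degree, fibres, identity principle -/

/-- The point of the sphere with homogeneous coordinates `[a : b]`. -/
def sphereMk (a b : ℂ) : OnePoint ℂ :=
  if b = 0 then OnePoint.infty else ((a / b : ℂ) : OnePoint ℂ)

lemma sphereMk_zero (a : ℂ) : sphereMk a 0 = OnePoint.infty := by simp [sphereMk]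

lemma sphereMk_of_ne {a b : ℂ} (hb : b ≠ 0) : sphereMk a b = ((a / b : ℂ) : OnePoint ℂ) := by
  simp [sphereMk, hb]

lemma sphereMk_one (a : ℂ) : sphereMk a 1 = (a : OnePoint ℂ) := by simp [sphereMk]

@[simp] lemma sphereCoord_infty : sphereCoord OnePoint.infty = ![1, 0] := rfl

@[simp] lemma sphereCoord_coe (t : ℂ) : sphereCoord (t : OnePoint ℂ) = ![t, 1] := rfl

lemma sphereMk_eq_infty {a b : ℂ} : sphereMk a b = OnePoint.infty ↔ b = 0 := by
  unfold sphereMk; split_ifs with h <;> simp [h]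

lemma sphereMk_eq_coe {a b t : ℂ} : sphereMk a b = (t : OnePoint ℂ) ↔ b ≠ 0 ∧ a = t * b := by
  unfold sphereMk; split_ifs with h
  · simp [h]
  · simp only [OnePoint.coe_eq_coe, ne_eq, h, not_false_eq_true, true_and]
    exact div_eq_iff h

/-- The hypotheses exclude `[0 : 0]`, which `sphereMk` sends to `∞` by default. -/
lemma sphereMk_eq_iff {a b c d : ℂ} (h : a ≠ 0 ∨ b ≠ 0) (h' : c ≠ 0 ∨ d ≠ 0) :
    sphereMk a b = sphereMk c d ↔ a * d = b * c := by
  by_cases hd : d = 0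
  · subst hd
    have hc : c ≠ 0 := by simpa using h'
    simp [sphereMk_zero, sphereMk_eq_infty, hc]
  · rw [sphereMk_of_ne hd, sphereMk_eq_coe]
    constructor
    · rintro ⟨hb, rfl⟩; field_simp
    · intro e
      have hb : b ≠ 0 := by
        rintro rfl
        simp [hd] at e
        simp [e] at h
      refine ⟨hb, ?_⟩
      field_simp
      linear_combination e

lemma sphereMk_mul {a b c : ℂ} (hc : c ≠ 0) : sphereMk (c * a) (c * b) = sphereMk a b := by
  unfold sphereMk
  by_cases hb : b = 0
  · simp [hb]
  · simp [hb, hc, mul_div_mul_left]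

lemma sphereCoord_ne_zero (z : OnePoint ℂ) : sphereCoord z 0 ≠ 0 ∨ sphereCoord z 1 ≠ 0 := by
  induction z using OnePoint.rec <;> simp

lemma sphereMk_sphereCoord (z : OnePoint ℂ) : sphereMk (sphereCoord z 0) (sphereCoord z 1) = z := by
  induction z using OnePoint.rec <;> simp [sphereMk]

/-- Turns the proportionality clause in the definitions of morphisms and rational maps into an
equality of points of the sphere. -/
lemma exists_sphereCoord_eq_iff {v : Fin 2 → ℂ} (hv : ∃ i, v i ≠ 0) {z : OnePoint ℂ} :
    (∃ c : ℂ, sphereCoord z = fun i => c * v i) ↔ z = sphereMk (v 0) (v 1) := by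
  constructor
  · rintro ⟨c, hc⟩
    have hc0 : c ≠ 0 := by
      rintro rfl
      rcases sphereCoord_ne_zero z with h | h <;> simp [hc] at h
    rw [← sphereMk_sphereCoord z, hc, sphereMk_mul hc0]
  · rintro rfl
    by_cases h : v 1 = 0
    · have h0 : v 0 ≠ 0 := by
        obtain ⟨i, hi⟩ := hv
        fin_cases i
        · exact hi
        · exact absurd h hi
      refine ⟨(v 0)⁻¹, ?_⟩
      ext i
      fin_cases i <;> simp [h, sphereMk_zero, h0]
    · refine ⟨(v 1)⁻¹, ?_⟩
      ext i
      fin_cases i <;> simp [h, sphereMk_of_ne, div_eq_inv_mul]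

lemma MvPolynomial.IsHomogeneous.eval_const_mul {σ : Type*} [Fintype σ] {R : Type*} [CommRing R]
    {F : MvPolynomial σ R} {d : ℕ} (hF : F.IsHomogeneous d) (c : R) (v : σ → R) :
    MvPolynomial.eval (fun i => c * v i) F = c ^ d * MvPolynomial.eval v F := by
  rw [MvPolynomial.eval_eq', MvPolynomial.eval_eq', Finset.mul_sum]
  refine Finset.sum_congr rfl fun m hm => ?_
  have hd : ∑ i, m i = d := by
    have := hF (MvPolynomial.mem_support_iff.mp hm)
    rw [← this, ← Finsupp.degree_eq_sum, Finsupp.degree_eq_weight_one]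
    rfl
  simp_rw [mul_pow]
  rw [Finset.prod_mul_distrib, Finset.prod_pow_eq_pow_sum, hd]
  ring

/-- `f = [p : q]` with `p`, `q` coprime and `d = max (deg p) (deg q)`. -/
structure IsRatPair (d : ℕ) (p q : ℂ[X]) (f : OnePoint ℂ → OnePoint ℂ) : Prop where
  natDegree_left : p.natDegree ≤ d
  natDegree_right : q.natDegree ≤ d
  coprime : IsCoprime p q
  coeff_ne : p.coeff d ≠ 0 ∨ q.coeff d ≠ 0
  map_coe : ∀ z : ℂ, f z = sphereMk (p.eval z) (q.eval z)
  map_infty : f OnePoint.infty = sphereMk (p.coeff d) (q.coeff d)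

lemma isCoprime_iff_eval_ne_zero {p q : ℂ[X]} :
    IsCoprime p q ↔ ∀ z : ℂ, p.eval z ≠ 0 ∨ q.eval z ≠ 0 := by
  rw [isCoprime_iff_aeval_ne_zero_of_isAlgClosed ℂ ℂ]
  simp

lemma IsRatPair.eval_ne {d : ℕ} {p q : ℂ[X]} {f : OnePoint ℂ → OnePoint ℂ}
    (h : IsRatPair d p q f) (z : ℂ) : p.eval z ≠ 0 ∨ q.eval z ≠ 0 :=
  isCoprime_iff_eval_ne_zero.mp h.coprime z

lemma eval_homogenize_one_zero (p : ℂ[X]) (d : ℕ) :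
    MvPolynomial.eval ![1, 0] (p.homogenize d) = p.coeff d := by
  rw [MvPolynomial.eval_eq']
  simp only [Fin.prod_univ_two, Matrix.cons_val_zero, one_pow, Matrix.cons_val_one, one_mul]
  rw [Finset.sum_eq_single (Finsupp.single 0 d)]
  · simp [coeff_homogenize]
  · intro m _ hm
    rw [coeff_homogenize]
    split_ifs with h
    · have : m 1 ≠ 0 := by
        intro h1
        apply hm
        ext i
        fin_cases i
        · simpa [h1] using h
        · simpa using h1
      simp [this]
    · simp
  · intro hm
    simpa using hm

/-- Dehomogenization: setting the second coordinate to 1 gives polynomials in one variable, and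
evaluation at `∞ = [1 : 0]` becomes the coefficient in degree `d`. Having no common zero on the
sphere thus splits into coprimality and a nonzero coefficient in degree `d`. -/
lemma isRationalMap_iff {f : OnePoint ℂ → OnePoint ℂ} :
    IsRationalMap f ↔ ∃ (d : ℕ) (p q : ℂ[X]), IsRatPair d p q f := by
  constructor
  · rintro ⟨d, F, hF, h⟩
    set p : Fin 2 → ℂ[X] := fun i => MvPolynomial.aeval ![X, 1] (F i) with hp
    have hdeg : ∀ i, (p i).natDegree ≤ d := by
      intro i
      have := MvPolynomial.aeval_natDegree_le (F i) (m := d) (n := 1) (hF i).totalDegree_le ![X, 1]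
        (by intro j; fin_cases j <;> simp)
      simpa using this
    have hhom : ∀ i, (p i).homogenize d = F i := fun i =>
      homogenize_eq_of_isHomogeneous (hF i) rfl
    have e1 : ∀ i (z : ℂ), MvPolynomial.eval ![z, 1] (F i) = (p i).eval z := by
      intro i z
      rw [← hhom i, eval_homogenize (hdeg i) _ (by simp)]
      simp
    have e2 : ∀ i, MvPolynomial.eval ![1, 0] (F i) = (p i).coeff d := by
      intro i
      rw [← hhom i, eval_homogenize_one_zero]
    have key : ∀ z, f z = sphereMk (MvPolynomial.eval (sphereCoord z) (F 0))
        (MvPolynomial.eval (sphereCoord z) (F 1)) := fun z =>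
      (exists_sphereCoord_eq_iff (h z).1).mp (h z).2
    refine ⟨d, p 0, p 1, hdeg 0, hdeg 1, ?_, ?_, ?_, ?_⟩
    · rw [isCoprime_iff_eval_ne_zero]
      intro z
      have := (h z).1
      simpa [Fin.exists_fin_two, e1] using this
    · have := (h OnePoint.infty).1
      simpa [Fin.exists_fin_two, e2] using this
    · intro z
      simpa [e1] using key z
    · simpa [e2] using key OnePoint.infty
  · rintro ⟨d, p, q, h⟩
    refine ⟨d, ![p.homogenize d, q.homogenize d], ?_, ?_⟩
    · intro i
      fin_cases i <;> exact isHomogeneous_homogenize _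
    · intro z
      have hne : ∃ i, MvPolynomial.eval (sphereCoord z)
          ((![p.homogenize d, q.homogenize d] : Fin 2 → MvPolynomial (Fin 2) ℂ) i) ≠ 0 := by
        rw [Fin.exists_fin_two]
        induction z using OnePoint.rec with
        | infty => simpa [eval_homogenize_one_zero] using h.coeff_ne
        | coe z =>
          simpa [eval_homogenize h.natDegree_left, eval_homogenize h.natDegree_right]
            using h.eval_ne z
      refine ⟨hne, (exists_sphereCoord_eq_iff hne).mpr ?_⟩
      induction z using OnePoint.rec with
      | infty => simpa [eval_homogenize_one_zero] using h.map_infty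
      | coe z =>
        simpa [eval_homogenize h.natDegree_left, eval_homogenize h.natDegree_right]
          using h.map_coe z

lemma IsRationalMap.comp {f g : OnePoint ℂ → OnePoint ℂ} (hf : IsRationalMap f)
    (hg : IsRationalMap g) : IsRationalMap (f ∘ g) := by
  obtain ⟨d, F, hF, h⟩ := hf
  obtain ⟨e, G, hG, k⟩ := hg
  refine ⟨e * d, fun i => MvPolynomial.aeval G (F i), fun i => (hF i).aeval G hG, fun z => ?_⟩
  obtain ⟨⟨i, hi⟩, c, hc⟩ := k z
  have hc0 : c ≠ 0 := by
    rintro rfl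
    rcases sphereCoord_ne_zero (g z) with h | h <;> simp [hc] at h
  have ev : ∀ i, MvPolynomial.eval (sphereCoord (g z)) (F i) =
      c ^ d * MvPolynomial.eval (sphereCoord z) (MvPolynomial.aeval G (F i)) := by
    intro i
    rw [hc, (hF i).eval_const_mul, ← MvPolynomial.coe_aeval_eq_eval, ← MvPolynomial.coe_aeval_eq_eval]
    simp only [RingHom.coe_coe]
    rw [← AlgHom.comp_apply, MvPolynomial.comp_aeval]
  obtain ⟨⟨i', hi'⟩, c', hc'⟩ := h (g z)
  refine ⟨⟨i', fun h0 => hi' ?_⟩, c' * c ^ d, ?_⟩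
  · rw [ev, h0, mul_zero]
  · simp only [Function.comp]
    rw [hc']
    ext i
    rw [ev]
    ring

/-- A Möbius transformation in coordinates. -/
lemma isRatPair_smul (g : GL (Fin 2) ℂ) :
    IsRatPair 1 (C (g 0 0) * X + C (g 0 1)) (C (g 1 0) * X + C (g 1 1))
      (fun z : OnePoint ℂ => g • z) := by
  have hdet : g 0 0 * g 1 1 - g 0 1 * g 1 0 ≠ 0 := by
    have := g.det.ne_zero
    rwa [Matrix.GeneralLinearGroup.val_det_apply, Matrix.det_fin_two] at this
  refine ⟨natDegree_linear_le, natDegree_linear_le, ?_, ?_, ?_, ?_⟩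
  · rw [isCoprime_iff_eval_ne_zero]
    intro z
    by_contra! h
    simp only [eval_add, eval_mul, eval_C, eval_X] at h
    obtain ⟨h1, h2⟩ := h
    by_cases hc : g 1 0 = 0
    · rw [hc] at h2 hdet
      simp only [zero_mul, zero_add] at h2
      simp [h2] at hdet
    · apply hdet
      have : g 1 0 * (g 0 0 * g 1 1 - g 0 1 * g 1 0) = 0 := by
        linear_combination (g 0 0 * g 1 0) * h2 - (g 1 0) ^ 2 * h1
      exact (mul_eq_zero.mp this).resolve_left hc
  · by_contra! h
    simp at h
    simp [h] at hdet
  · intro z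
    simp only [OnePoint.smul_some_eq_ite, sphereMk, eval_add, eval_mul, eval_C, eval_X]
  · simp [OnePoint.smul_infty_eq_ite, sphereMk]

lemma isRationalMap_smul (g : GL (Fin 2) ℂ) :
    IsRationalMap (fun z : OnePoint ℂ => g • z) :=
  isRationalMap_iff.mpr ⟨_, _, _, isRatPair_smul g⟩

lemma isMobius_toPerm (g : GL (Fin 2) ℂ) :
    IsMobius (MulAction.toPerm g : OnePoint ℂ ≃ OnePoint ℂ) :=
  ⟨isRationalMap_smul g, isRationalMap_smul g⁻¹⟩

lemma IsMobius.symm {μ : OnePoint ℂ ≃ OnePoint ℂ} (h : IsMobius μ) : IsMobius μ.symm :=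
  ⟨h.2, h.1⟩

lemma IsMobius.trans {μ ν : OnePoint ℂ ≃ OnePoint ℂ} (h : IsMobius μ) (h' : IsMobius ν) :
    IsMobius (μ.trans ν) :=
  ⟨h'.1.comp h.1, h.2.comp h'.2⟩

lemma isRationalMap_id : IsRationalMap id := by
  convert isRationalMap_smul 1 using 2
  simp

lemma isMobius_refl : IsMobius (Equiv.refl (OnePoint ℂ)) :=
  ⟨isRationalMap_id, isRationalMap_id⟩

/-- A rational function of degree one is a Möbius transformation. -/
lemma IsRatPair.exists_smul {p q : ℂ[X]} {f : OnePoint ℂ → OnePoint ℂ} (h : IsRatPair 1 p q f) :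
    ∃ g : GL (Fin 2) ℂ, f = fun z => g • z := by
  have hp : p = C (p.coeff 1) * X + C (p.coeff 0) := eq_X_add_C_of_natDegree_le_one h.natDegree_left
  have hq : q = C (q.coeff 1) * X + C (q.coeff 0) := eq_X_add_C_of_natDegree_le_one h.natDegree_right
  set a := p.coeff 1 with ha
  set b := p.coeff 0
  set c := q.coeff 1 with hc'
  set d := q.coeff 0
  have hdet : (Matrix.of ![![a, b], ![c, d]]).det ≠ 0 := by
    rw [Matrix.det_fin_two]
    simp only [Matrix.of_apply, Matrix.cons_val_zero, Matrix.cons_val_one]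
    intro h0
    by_cases hc : c = 0
    · have h1 : a ≠ 0 := by
        have := h.coeff_ne
        rw [← ha, ← hc', hc] at this
        simpa using this
      have := h.eval_ne (-b / a)
      rw [hp, hq] at this
      simp only [eval_add, eval_mul, eval_C, eval_X, hc] at this
      rw [hc] at h0
      have hd : d = 0 := by simpa [h1] using h0
      rcases this with this | this
      · apply this; field_simp; ring
      · apply this; simp [hd]
    · have := h.eval_ne (-d / c)
      rw [hp, hq] at this
      simp only [eval_add, eval_mul, eval_C, eval_X] at this
      rcases this with this | this
      · apply this; field_simp; linear_combination -h0
      · apply this; field_simp; ring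
  refine ⟨Matrix.GeneralLinearGroup.mkOfDetNeZero _ hdet, ?_⟩
  funext z
  induction z using OnePoint.rec with
  | infty =>
    rw [OnePoint.smul_infty_eq_ite, h.map_infty, ← ha, ← hc', sphereMk]
    rfl
  | coe z =>
    rw [OnePoint.smul_some_eq_ite, h.map_coe, hp, hq]
    simp only [eval_add, eval_mul, eval_C, eval_X, sphereMk]
    rfl

lemma IsRatPair.isInvertibleMap {p q : ℂ[X]} {f : OnePoint ℂ → OnePoint ℂ}
    (h : IsRatPair 1 p q f) : IsInvertibleMap f := by
  obtain ⟨g, rfl⟩ := h.exists_smul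
  exact ⟨_, isMobius_toPerm g, rfl⟩

/-- A root of `p - t q` is mapped to `t`. If there is none, `p - t q` is a nonzero constant, its
coefficient in degree `d > 0` vanishes, and `∞` is mapped to `t`. -/
lemma IsRatPair.surjective {d : ℕ} {p q : ℂ[X]} {f : OnePoint ℂ → OnePoint ℂ}
    (h : IsRatPair d p q f) (hd : d ≠ 0) : Function.Surjective f := by
  intro t
  induction t using OnePoint.rec with
  | infty =>
    by_cases hq : q.degree = 0
    · refine ⟨OnePoint.infty, ?_⟩
      rw [h.map_infty, sphereMk_eq_infty]
      apply coeff_eq_zero_of_natDegree_lt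
      rw [natDegree_eq_of_degree_eq_some hq]
      exact Nat.pos_of_ne_zero hd
    · obtain ⟨z, hz⟩ := IsAlgClosed.exists_root q hq
      exact ⟨z, by rw [h.map_coe, sphereMk_eq_infty]; exact hz⟩
  | coe t =>
    by_cases hr : (p - C t * q).degree = 0
    · refine ⟨OnePoint.infty, ?_⟩
      have h0 : (p - C t * q).coeff d = 0 := by
        apply coeff_eq_zero_of_natDegree_lt
        rw [natDegree_eq_of_degree_eq_some hr]
        exact Nat.pos_of_ne_zero hd
      rw [coeff_sub, coeff_C_mul, sub_eq_zero] at h0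
      rw [h.map_infty, sphereMk_eq_coe]
      refine ⟨fun hq => ?_, h0⟩
      have := h.coeff_ne
      rw [h0, hq] at this
      simp at this
    · obtain ⟨z, hz⟩ := IsAlgClosed.exists_root _ hr
      refine ⟨z, ?_⟩
      have h0 : p.eval z = t * q.eval z := by
        simpa [IsRoot, sub_eq_zero] using hz
      rw [h.map_coe, sphereMk_eq_coe]
      refine ⟨fun hq => ?_, h0⟩
      have := h.eval_ne z
      rw [h0, hq] at this
      simp at this

lemma IsRatPair.eq_const {p q : ℂ[X]} {f : OnePoint ℂ → OnePoint ℂ}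
    (h : IsRatPair 0 p q f) (z : OnePoint ℂ) : f z = f OnePoint.infty := by
  induction z using OnePoint.rec with
  | infty => rfl
  | coe z =>
    rw [h.map_coe, h.map_infty]
    conv_lhs => rw [eq_C_of_natDegree_le_zero h.natDegree_left, eq_C_of_natDegree_le_zero h.natDegree_right]
    simp

/-- If `p' q = p q'`, coprimality gives `p ∣ p'` and `q ∣ q'`. Then both are constant, and neither
has a nonzero coefficient in degree `d > 0`. -/
lemma IsRatPair.wronskian_ne_zero {d : ℕ} {p q : ℂ[X]} {f : OnePoint ℂ → OnePoint ℂ}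
    (h : IsRatPair d p q f) (hd : d ≠ 0) : derivative p * q - p * derivative q ≠ 0 := by
  intro h0
  rw [sub_eq_zero] at h0
  have key : ∀ r : ℂ[X], r ∣ derivative r → r.natDegree = 0 := by
    intro r hr
    by_contra hne
    have hr0 : derivative r ≠ 0 := by
      intro h1
      exact hne (derivative_eq_zero.mp h1)
    have := natDegree_le_of_dvd hr hr0
    have := natDegree_derivative_lt hne
    omega
  have h1 : p.natDegree = 0 := key p (h.coprime.dvd_of_dvd_mul_right (Dvd.intro _ h0.symm))
  have h2 : q.natDegree = 0 :=
    key q (h.coprime.symm.dvd_of_dvd_mul_left (Dvd.intro_left _ h0))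
  rcases h.coeff_ne with h3 | h3
  · exact h3 (coeff_eq_zero_of_natDegree_lt (by omega))
  · exact h3 (coeff_eq_zero_of_natDegree_lt (by omega))

/-- All but finitely many fibres of a rational function of degree `d` have `d` points. -/
lemma IsRatPair.finite_ncard_fibre_ne {d : ℕ} {p q : ℂ[X]} {f : OnePoint ℂ → OnePoint ℂ}
    (h : IsRatPair d p q f) : {t : OnePoint ℂ | (f ⁻¹' {t}).ncard ≠ d}.Finite := by
  rcases Nat.eq_zero_or_pos d with rfl | hd
  · refine (Set.finite_singleton (f OnePoint.infty)).subset fun t ht => ?_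
    by_contra hne
    apply ht
    have : f ⁻¹' {t} = ∅ := by
      ext z
      simp only [Set.mem_preimage, Set.mem_singleton_iff, Set.mem_empty_iff_false, iff_false]
      rw [h.eq_const z]
      exact fun e => hne e.symm
    rw [this, Set.ncard_empty]
  · have hw := h.wronskian_ne_zero hd.ne'
    set w := derivative p * q - p * derivative q with hw'
    -- The excluded values are `∞`, `f ∞` and the images of the zeros of the Wronskian. For any
    -- other `t`, the polynomial `p - t q` has degree exactly `d` and simple roots.
    refine (((Set.finite_singleton OnePoint.infty).union (Set.finite_singleton (f OnePoint.infty))).union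
      ((w.roots.toFinset.finite_toSet).image fun z : ℂ => f z)).subset fun t ht => ?_
    by_contra hne
    simp only [Set.mem_union, Set.mem_singleton_iff, Set.mem_image, not_or, not_exists, not_and] at hne
    obtain ⟨⟨h1, h2⟩, h3⟩ := hne
    apply ht
    clear ht
    induction t using OnePoint.rec with
    | infty => exact absurd rfl h1
    | coe t =>
      set r := p - C t * q with hr
      have hcoeff : r.coeff d ≠ 0 := by
        intro h0
        apply h2
        rw [hr, coeff_sub, coeff_C_mul, sub_eq_zero] at h0
        rw [h.map_infty, eq_comm, sphereMk_eq_coe]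
        refine ⟨fun hq => ?_, h0⟩
        have := h.coeff_ne
        rw [h0, hq] at this
        simp at this
      have hr0 : r ≠ 0 := by
        intro h0
        rw [h0] at hcoeff
        simp at hcoeff
      have hdeg : r.natDegree = d := by
        apply le_antisymm
        · refine (natDegree_sub_le _ _).trans (max_le h.natDegree_left ?_)
          exact (natDegree_C_mul_le _ _).trans h.natDegree_right
        · exact le_natDegree_of_ne_zero hcoeff
      have hmem : ∀ z : ℂ, f z = (t : OnePoint ℂ) ↔ r.eval z = 0 := by
        intro z
        rw [h.map_coe, sphereMk_eq_coe, hr]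
        simp only [eval_sub, eval_mul, eval_C, sub_eq_zero]
        constructor
        · exact fun e => e.2
        · intro e
          refine ⟨fun hq => ?_, e⟩
          have := h.eval_ne z
          rw [e, hq] at this
          simp at this
      have hnodup : r.roots.Nodup := by
        apply nodup_roots
        rw [Separable, isCoprime_iff_eval_ne_zero]
        intro z
        by_contra! hz
        obtain ⟨hz1, hz2⟩ := hz
        refine h3 z ?_ ((hmem z).mpr hz1)
        simp only [Finset.mem_coe, Multiset.mem_toFinset, mem_roots hw, IsRoot]
        simp only [hr, eval_sub, eval_mul, eval_C, derivative_sub, derivative_C_mul, sub_eq_zero] at hz1 hz2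
        simp only [hw', eval_sub, eval_mul, hz1, hz2]
        ring
      have hset : f ⁻¹' {(t : OnePoint ℂ)} = (fun z : ℂ => (z : OnePoint ℂ)) '' (r.roots.toFinset : Set ℂ) := by
        ext z
        simp only [Set.mem_preimage, Set.mem_singleton_iff, Set.mem_image, Finset.mem_coe,
          Multiset.mem_toFinset, mem_roots hr0, IsRoot]
        induction z using OnePoint.rec with
        | infty => simp [Ne.symm h2]
        | coe z => simp [hmem]
      rw [hset, Set.ncard_image_of_injective _ OnePoint.coe_injective, Set.ncard_coe_finset,
        Multiset.toFinset_card_of_nodup hnodup, IsAlgClosed.card_roots_eq_natDegree, hdeg]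

/-- The degree of a rational function is the size of its fibres over an infinite set. -/
lemma IsRatPair.degree_eq {d n : ℕ} {p q : ℂ[X]} {f : OnePoint ℂ → OnePoint ℂ}
    (h : IsRatPair d p q f) {B : Set (OnePoint ℂ)} (hB : B.Finite)
    (hf : ∀ t ∉ B, (f ⁻¹' {t}).ncard = n) : d = n := by
  obtain ⟨t, ht⟩ := ((hB.union h.finite_ncard_fibre_ne).infinite_compl).nonempty
  simp only [Set.mem_compl_iff, Set.mem_union, Set.mem_ofPred_eq, not_or, not_not] at ht
  rw [← ht.2, hf t ht.1]

lemma IsRatPair.degree_eq_one_of_injective {d : ℕ} {p q : ℂ[X]} {f : OnePoint ℂ → OnePoint ℂ}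
    (h : IsRatPair d p q f) (hf : Function.Injective f) : d = 1 := by
  have hd : d ≠ 0 := by
    rintro rfl
    have := hf (h.eq_const ((0 : ℂ) : OnePoint ℂ))
    simp at this
  refine h.degree_eq Set.finite_empty fun t _ => ?_
  obtain ⟨z, rfl⟩ := h.surjective hd t
  rw [← Set.image_singleton, hf.preimage_image, Set.ncard_singleton]

lemma IsRationalMap.exists_smul_of_injective {f : OnePoint ℂ → OnePoint ℂ} (h : IsRationalMap f)
    (hf : Function.Injective f) : ∃ g : GL (Fin 2) ℂ, f = fun z => g • z := by
  obtain ⟨d, p, q, h⟩ := isRationalMap_iff.mp h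
  obtain rfl := h.degree_eq_one_of_injective hf
  exact h.exists_smul

lemma IsRationalMap.isInvertibleMap_of_injective {f : OnePoint ℂ → OnePoint ℂ}
    (h : IsRationalMap f) (hf : Function.Injective f) : IsInvertibleMap f := by
  obtain ⟨g, rfl⟩ := h.exists_smul_of_injective hf
  exact ⟨_, isMobius_toPerm g, rfl⟩

lemma IsInvertibleMap.injective {f : OnePoint ℂ → OnePoint ℂ} (h : IsInvertibleMap f) :
    Function.Injective f := by
  obtain ⟨μ, _, rfl⟩ := h
  exact μ.injective

/-- Rational functions that agree on an infinite set are equal. -/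
lemma IsRationalMap.eq_of_infinite {f g : OnePoint ℂ → OnePoint ℂ} (hf : IsRationalMap f)
    (hg : IsRationalMap g) (h : {z | f z = g z}.Infinite) : f = g := by
  obtain ⟨d, p, q, hf⟩ := isRationalMap_iff.mp hf
  obtain ⟨e, r, s, hg⟩ := isRationalMap_iff.mp hg
  have h0 : p * s - q * r = 0 := by
    by_contra hne
    apply h
    refine ((Set.finite_singleton OnePoint.infty).union
      (((p * s - q * r).roots.toFinset.finite_toSet).image fun z : ℂ => (z : OnePoint ℂ))).subset
      fun z hz => ?_
    induction z using OnePoint.rec with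
    | infty => simp
    | coe z =>
      right
      refine ⟨z, ?_, rfl⟩
      simp only [Set.mem_ofPred_eq, hf.map_coe, hg.map_coe] at hz
      rw [sphereMk_eq_iff (hf.eval_ne z) (hg.eval_ne z)] at hz
      simp [mem_roots hne, IsRoot, hz]
  rw [sub_eq_zero] at h0
  funext z
  induction z using OnePoint.rec with
  | infty =>
    rw [hf.map_infty, hg.map_infty, sphereMk_eq_iff hf.coeff_ne hg.coeff_ne,
      ← coeff_mul_add_eq_of_natDegree_le hf.natDegree_left hg.natDegree_right,
      ← coeff_mul_add_eq_of_natDegree_le hf.natDegree_right hg.natDegree_left, h0]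
  | coe z =>
    rw [hf.map_coe, hg.map_coe, sphereMk_eq_iff (hf.eval_ne z) (hg.eval_ne z),
      ← eval_mul, ← eval_mul, h0]

lemma exists_isRatPair {p q : ℂ[X]} (h : IsCoprime p q) :
    ∃ f, IsRatPair (max p.natDegree q.natDegree) p q f := by
  refine ⟨fun z => z.elim (sphereMk (p.coeff (max p.natDegree q.natDegree))
    (q.coeff (max p.natDegree q.natDegree))) fun z => sphereMk (p.eval z) (q.eval z),
    le_max_left _ _, le_max_right _ _, h, ?_, fun z => rfl, rfl⟩
  by_contra! h0
  have hp : p = 0 := by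
    rcases le_total p.natDegree q.natDegree with hle | hle
    · rw [max_eq_right hle, coeff_natDegree, leadingCoeff_eq_zero] at h0
      rw [h0.2, natDegree_zero, nonpos_iff_eq_zero] at hle
      have := h0.1
      rwa [h0.2, natDegree_zero, ← hle, coeff_natDegree, leadingCoeff_eq_zero] at this
    · rw [max_eq_left hle, coeff_natDegree, leadingCoeff_eq_zero] at h0
      exact h0.1
  have hq : q = 0 := by
    simpa [hp] using h0.2
  have := isCoprime_iff_eval_ne_zero.mp h 0
  simp [hp, hq] at this

/-- A pair of polynomials that are not both zero defines a rational function. -/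
lemma exists_isRationalMap (p q : ℂ[X]) (h : p ≠ 0 ∨ q ≠ 0) :
    ∃ f, IsRationalMap f ∧
      ∀ z : ℂ, (p.eval z ≠ 0 ∨ q.eval z ≠ 0) → f z = sphereMk (p.eval z) (q.eval z) := by
  have hcop : ∃ g p' q' : ℂ[X], IsCoprime p' q' ∧ p = g * p' ∧ q = g * q' := by
    classical
    have hg : EuclideanDomain.gcd p q ≠ 0 := by
      rw [Ne, EuclideanDomain.gcd_eq_zero_iff]
      tauto
    obtain ⟨p', hp'⟩ := EuclideanDomain.gcd_dvd_left p q
    obtain ⟨q', hq'⟩ := EuclideanDomain.gcd_dvd_right p q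
    refine ⟨EuclideanDomain.gcd p q, p', q', ?_, hp', hq'⟩
    refine ⟨EuclideanDomain.gcdA p q, EuclideanDomain.gcdB p q, ?_⟩
    have := EuclideanDomain.gcd_eq_gcd_ab p q
    apply mul_left_cancel₀ hg
    conv_rhs => rw [mul_one, this]
    conv_rhs => enter [1, 1]; rw [hp']
    conv_rhs => enter [2, 1]; rw [hq']
    ring
  obtain ⟨g, p', q', hc, rfl, rfl⟩ := hcop
  obtain ⟨f, hf⟩ := exists_isRatPair hc
  refine ⟨f, isRationalMap_iff.mpr ⟨_, _, _, hf⟩, fun z hz => ?_⟩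
  have hg : g.eval z ≠ 0 := by
    intro h0
    simp [h0] at hz
  rw [hf.map_coe, eval_mul, eval_mul, sphereMk_mul hg]

/-! ### Composition of morphisms -/

open WeierstrassCurve (Affine)

lemma IsMorphism.comp {X Y Z : Type} {m n k : ℕ} {cX : X → Fin m → ℂ} {cY : Y → Fin n → ℂ}
    {cZ : Z → Fin k → ℂ} {g : Y → Z} {f : X → Y} (hg : IsMorphism cY cZ g)
    (hf : IsMorphism cX cY f) (hY : ∀ y, ∃ i, cY y i ≠ 0) : IsMorphism cX cZ (g ∘ f) := by
  intro P
  obtain ⟨d, F, hF, hFP, hFQ⟩ := hf P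
  obtain ⟨e, G, hG, ⟨i, hi⟩, hGQ⟩ := hg (f P)
  have hsc : ∀ Q, ∀ c : ℂ, (cY (f Q) = fun i => c * MvPolynomial.eval (cX Q) (F i)) → c ≠ 0 ∧
      ∀ j, MvPolynomial.eval (cY (f Q)) (G j) =
        c ^ e * MvPolynomial.eval (cX Q) (MvPolynomial.aeval F (G j)) := by
    intro Q c hc
    refine ⟨?_, fun j => ?_⟩
    · rintro rfl
      obtain ⟨i, hi⟩ := hY (f Q)
      simp [hc] at hi
    · rw [hc, (hG j).eval_const_mul, ← MvPolynomial.coe_aeval_eq_eval,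
        ← MvPolynomial.coe_aeval_eq_eval]
      simp only [RingHom.coe_coe]
      rw [← AlgHom.comp_apply, MvPolynomial.comp_aeval]
  refine ⟨d * e, fun j => MvPolynomial.aeval F (G j), fun j => (hG j).aeval F hF, ?_, ?_⟩
  · obtain ⟨c, hc⟩ := hFQ P hFP
    refine ⟨i, fun h0 => hi ?_⟩
    rw [(hsc P c hc).2, h0, mul_zero]
  · rintro Q ⟨j, hj⟩
    by_cases hQ : ∃ i, MvPolynomial.eval (cX Q) (F i) ≠ 0
    · obtain ⟨c, hc⟩ := hFQ Q hQ
      obtain ⟨hc0, hcj⟩ := hsc Q c hc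
      obtain ⟨c', hc'⟩ := hGQ (f Q) ⟨j, by rw [hcj]; exact mul_ne_zero (pow_ne_zero _ hc0) hj⟩
      refine ⟨c' * c ^ e, ?_⟩
      simp only [Function.comp]
      rw [hc']
      ext l
      rw [hcj]
      ring
    -- The formula must also hold where all `F i` vanish but the composed polynomials do not. There
    -- they take the values `G(0)`, so `e = 0`, the `G l` are constants, and their formula for `g`
    -- applies at `f Q`.
    · push Not at hQ
      have ev : ∀ l v, (∀ i, MvPolynomial.eval v (F i) = 0) →
          MvPolynomial.eval v (MvPolynomial.aeval F (G l)) = MvPolynomial.eval 0 (G l) := by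
        intro l v hv
        rw [← MvPolynomial.coe_aeval_eq_eval]
        simp only [RingHom.coe_coe]
        rw [← AlgHom.comp_apply, MvPolynomial.comp_aeval]
        have h0 : (fun i => MvPolynomial.aeval v (F i)) = (0 : Fin n → ℂ) := funext hv
        rw [h0]
        rfl
      have he : e = 0 := by
        by_contra he
        apply hj
        rw [ev _ _ hQ]
        have := (hG j).eval_const_mul 0 (0 : Fin n → ℂ)
        simpa [he] using this
      subst he
      have hconst : ∀ l v, MvPolynomial.eval v (G l) = MvPolynomial.eval 0 (G l) := by
        intro l v
        have := (hG l).eval_const_mul 0 v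
        simp only [zero_mul, pow_zero, one_mul] at this
        exact this.symm
      obtain ⟨c', hc'⟩ := hGQ (f Q) ⟨j, by rw [hconst, ← ev j _ hQ]; exact hj⟩
      refine ⟨c', ?_⟩
      simp only [Function.comp]
      rw [hc']
      ext l
      rw [ev l _ hQ, hconst]

lemma curveCoord_ne_zero (W : WeierstrassCurve ℂ) (P : W.toAffine.Point) :
    ∃ i, curveCoord W P i ≠ 0 := by
  cases P with
  | zero => exact ⟨1, by simp [curveCoord]⟩
  | some x y h => exact ⟨2, by simp [curveCoord]⟩

lemma IsRationalMap.isMorphism {f : OnePoint ℂ → OnePoint ℂ} (h : IsRationalMap f) :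
    IsMorphism sphereCoord sphereCoord f := by
  obtain ⟨d, F, hF, h⟩ := h
  exact fun P => ⟨d, F, hF, (h P).1, fun Q _ => (h Q).2⟩

lemma IsRationalMap.comp_isMorphism {X : Type} {m : ℕ} {cX : X → Fin m → ℂ}
    {f : OnePoint ℂ → OnePoint ℂ} {g : X → OnePoint ℂ} (hf : IsRationalMap f)
    (hg : IsMorphism cX sphereCoord g) : IsMorphism cX sphereCoord (f ∘ g) :=
  hf.isMorphism.comp hg fun z => by
    rcases sphereCoord_ne_zero z with h | h
    exacts [⟨0, h⟩, ⟨1, h⟩]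

/-! ### Curves with a marked point of order two, and their `x`-coordinate -/

/-- The `x`-coordinate. -/
def xMap (W : WeierstrassCurve ℂ) : W.toAffine.Point → OnePoint ℂ
  | .zero => OnePoint.infty
  | .some x _ _ => (x : OnePoint ℂ)

@[simp] lemma xMap_zero (W : WeierstrassCurve ℂ) : xMap W 0 = OnePoint.infty := rfl

lemma sphereCoord_xMap (W : WeierstrassCurve ℂ) (P : W.toAffine.Point) :
    sphereCoord (xMap W P) = P.xRep := by
  cases P <;> rfl

lemma xMap_eq_iff {W : WeierstrassCurve ℂ} {P Q : W.toAffine.Point} :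
    xMap W P = xMap W Q ↔ P = Q ∨ P = -Q := by
  rw [← Affine.Point.xRep_eq_xRep_iff, ← sphereCoord_xMap, ← sphereCoord_xMap]
  refine ⟨fun h => by rw [h], fun h => ?_⟩
  rw [← sphereMk_sphereCoord (xMap W P), h, sphereMk_sphereCoord]

lemma xMap_neg {W : WeierstrassCurve ℂ} (P : W.toAffine.Point) : xMap W (-P) = xMap W P :=
  xMap_eq_iff.mpr (Or.inr rfl)

/-- The curve `y² = x³ + a x² + b x`, with the point `(0, 0)` of order two. -/
abbrev twoTorsionCurve (a b : ℂ) : WeierstrassCurve ℂ := ⟨0, a, 0, b, 0⟩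

namespace twoTorsionCurve

variable {a b : ℂ}

lemma delta (a b : ℂ) : (twoTorsionCurve a b).Δ = 16 * b ^ 2 * (a ^ 2 - 4 * b) := by
  simp only [WeierstrassCurve.Δ, WeierstrassCurve.b₂, WeierstrassCurve.b₄, WeierstrassCurve.b₆,
    WeierstrassCurve.b₈]
  ring

lemma isElliptic_iff : (twoTorsionCurve a b).IsElliptic ↔ b ≠ 0 ∧ a ^ 2 - 4 * b ≠ 0 := by
  rw [WeierstrassCurve.isElliptic_iff, isUnit_iff_ne_zero, delta]
  simp [not_or]

lemma b_ne_zero (h : (twoTorsionCurve a b).IsElliptic) : b ≠ 0 := (isElliptic_iff.mp h).1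

lemma disc_ne_zero (h : (twoTorsionCurve a b).IsElliptic) : a ^ 2 - 4 * b ≠ 0 :=
  (isElliptic_iff.mp h).2

lemma j_eq (h : (twoTorsionCurve a b).IsElliptic) : (twoTorsionCurve a b).j =
    256 * (a ^ 2 - 3 * b) ^ 3 / (b ^ 2 * (a ^ 2 - 4 * b)) := by
  have h1 := b_ne_zero h
  have h2 := disc_ne_zero h
  rw [WeierstrassCurve.j, Units.val_inv_eq_inv_val, WeierstrassCurve.coe_Δ', delta]
  simp only [WeierstrassCurve.c₄, WeierstrassCurve.b₂, WeierstrassCurve.b₄]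
  field_simp
  ring

lemma equation_iff {x y : ℂ} : (twoTorsionCurve a b).toAffine.Equation x y ↔
    y ^ 2 = x ^ 3 + a * x ^ 2 + b * x := by
  rw [Affine.equation_iff]
  simp

/-- Parity of degrees: a square has even degree, a cubic times a square has odd degree. This says
that `p(x) + y q(x)` has zero norm over `ℂ[x]` only if it is zero. -/
lemma eq_zero_of_norm_eq_zero {p q : ℂ[X]} (h : p ^ 2 = (X ^ 3 + C a * X ^ 2 + C b * X) * q ^ 2) :
    p = 0 ∧ q = 0 := by
  have hdeg : (X ^ 3 + C a * X ^ 2 + C b * X).natDegree = 3 := by compute_degree!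
  have hne : X ^ 3 + C a * X ^ 2 + C b * X ≠ 0 := by
    intro h0
    rw [h0] at hdeg
    simp at hdeg
  have hq : q = 0 := by
    by_contra hq
    have h1 := congrArg natDegree h
    rw [natDegree_mul hne (pow_ne_zero _ hq), natDegree_pow, natDegree_pow, hdeg] at h1
    omega
  subst hq
  simpa using h

variable [h : (twoTorsionCurve a b).IsElliptic]

/-- The affine point `(x, y)`. -/
def pt (x y : ℂ) (hxy : y ^ 2 = x ^ 3 + a * x ^ 2 + b * x) : (twoTorsionCurve a b).toAffine.Point :=
  .some x y (Affine.equation_iff_nonsingular.mp (equation_iff.mpr hxy))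

lemma eq_zero_or_eq_pt (P : (twoTorsionCurve a b).toAffine.Point) :
    P = 0 ∨ ∃ x y hxy, P = pt x y hxy := by
  cases P with
  | zero => exact Or.inl rfl
  | some x y h => exact Or.inr ⟨x, y, equation_iff.mp h.1, rfl⟩

lemma pt_ne_zero {x y : ℂ} (hxy : y ^ 2 = x ^ 3 + a * x ^ 2 + b * x) : pt x y hxy ≠ 0 :=
  Affine.Point.some_ne_zero _

lemma pt_inj {x y x' y' : ℂ} {hxy : y ^ 2 = x ^ 3 + a * x ^ 2 + b * x}
    {hxy' : y' ^ 2 = x' ^ 3 + a * x' ^ 2 + b * x'} :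
    pt x y hxy = pt x' y' hxy' ↔ x = x' ∧ y = y' := by
  unfold pt
  rw [Affine.Point.some.injEq]

@[simp] lemma xMap_pt {x y : ℂ} (hxy : y ^ 2 = x ^ 3 + a * x ^ 2 + b * x) :
    xMap _ (pt x y hxy) = (x : OnePoint ℂ) := rfl

lemma neg_pt {x y : ℂ} (hxy : y ^ 2 = x ^ 3 + a * x ^ 2 + b * x) :
    -pt x y hxy = pt x (-y) (by rw [neg_sq, hxy]) := by
  unfold pt
  rw [Affine.Point.neg_some]
  simp [Affine.negY]

lemma pt_congr {x y x' y' : ℂ} {hxy : y ^ 2 = x ^ 3 + a * x ^ 2 + b * x} (hx : x = x')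
    (hy : y = y') : pt x y hxy = pt x' y' (by rw [← hx, ← hy, hxy]) := by
  subst hx hy; rfl

lemma pt_add_pt_of_ne {x y x' y' : ℂ} (hxy : y ^ 2 = x ^ 3 + a * x ^ 2 + b * x)
    (hxy' : y' ^ 2 = x' ^ 3 + a * x' ^ 2 + b * x') (hne : x ≠ x') {ℓ X Y : ℂ}
    (hℓ : ℓ = (y - y') / (x - x')) (hX : X = ℓ ^ 2 - a - x - x') (hY : Y = -(ℓ * (X - x) + y))
    (hXY : Y ^ 2 = X ^ 3 + a * X ^ 2 + b * X) :
    pt x y hxy + pt x' y' hxy' = pt X Y hXY := by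
  unfold pt
  rw [Affine.Point.add_of_X_ne hne, Affine.Point.some.injEq, Affine.slope_of_X_ne hne]
  subst hY hX hℓ
  simp [Affine.addX, Affine.addY, Affine.negAddY, Affine.negY]

lemma two_smul_pt {x y : ℂ} (hxy : y ^ 2 = x ^ 3 + a * x ^ 2 + b * x) (hy : y ≠ 0) {ℓ X Y : ℂ}
    (hℓ : ℓ = (3 * x ^ 2 + 2 * a * x + b) / (2 * y)) (hX : X = ℓ ^ 2 - a - x - x)
    (hY : Y = -(ℓ * (X - x) + y)) (hXY : Y ^ 2 = X ^ 3 + a * X ^ 2 + b * X) :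
    2 • pt x y hxy = pt X Y hXY := by
  rw [two_nsmul]
  unfold pt
  have hne : y ≠ (twoTorsionCurve a b).toAffine.negY x y := by
    simp only [Affine.negY]
    intro e
    apply hy
    linear_combination e / 2
  rw [Affine.Point.add_self_of_Y_ne hne, Affine.Point.some.injEq, Affine.slope_of_Y_ne rfl hne]
  subst hY hX hℓ
  have : (3 * x ^ 2 + 2 * a * x + b - 0 * y) / (y - (twoTorsionCurve a b).toAffine.negY x y) =
      (3 * x ^ 2 + 2 * a * x + b) / (2 * y) := by
    simp only [Affine.negY]
    congr 1 <;> ring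
  rw [this]
  simp [Affine.addX, Affine.addY, Affine.negAddY, Affine.negY]

lemma two_smul_pt_zero {x : ℂ} (hxy : (0 : ℂ) ^ 2 = x ^ 3 + a * x ^ 2 + b * x) :
    2 • pt x 0 hxy = 0 := by
  rw [two_nsmul, add_eq_zero_iff_eq_neg, neg_pt]
  exact pt_congr rfl neg_zero.symm

lemma two_smul_pt_eq_zero_iff {x y : ℂ} (hxy : y ^ 2 = x ^ 3 + a * x ^ 2 + b * x) :
    2 • pt x y hxy = 0 ↔ y = 0 := by
  rw [two_nsmul, add_eq_zero_iff_eq_neg, neg_pt, pt_inj]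
  simp [self_eq_neg]

lemma xMap_surjective : Function.Surjective (xMap (twoTorsionCurve a b)) := by
  intro z
  induction z using OnePoint.rec with
  | infty => exact ⟨0, rfl⟩
  | coe x =>
    obtain ⟨y, hy⟩ := IsAlgClosed.exists_pow_nat_eq (x ^ 3 + a * x ^ 2 + b * x) (n := 2) (by norm_num)
    exact ⟨pt x y hy, rfl⟩

lemma xMap_fibre_finite (z : OnePoint ℂ) : (xMap (twoTorsionCurve a b) ⁻¹' {z}).Finite := by
  obtain ⟨P, rfl⟩ := xMap_surjective (a := a) (b := b) z
  refine (Set.toFinite {P, -P}).subset fun Q hQ => ?_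
  simpa using xMap_eq_iff.mp (show xMap _ Q = xMap _ P from hQ)

/-! ### Morphisms from the curve to the sphere: identity principle, even morphisms -/

/-- On the curve `y²` is a polynomial in `x`, so every power of `y` reduces to degree at most one.
-/
lemma exists_eval_eq (a b : ℂ) (F : MvPolynomial (Fin 3) ℂ) : ∃ p q : ℂ[X], ∀ x y : ℂ,
    y ^ 2 = x ^ 3 + a * x ^ 2 + b * x →
      MvPolynomial.eval ![x, y, 1] F = p.eval x + y * q.eval x := by
  induction F using MvPolynomial.induction_on with
  | C c => exact ⟨C c, 0, by simp⟩
  | add F G hF hG =>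
    obtain ⟨p, q, h⟩ := hF
    obtain ⟨p', q', h'⟩ := hG
    refine ⟨p + p', q + q', fun x y hxy => ?_⟩
    rw [map_add, h x y hxy, h' x y hxy, eval_add, eval_add]
    ring
  | mul_X F i hF =>
    obtain ⟨p, q, h⟩ := hF
    fin_cases i
    · refine ⟨X * p, X * q, fun x y hxy => ?_⟩
      rw [map_mul, h x y hxy]
      simp
      ring
    · refine ⟨(X ^ 3 + C a * X ^ 2 + C b * X) * q, p, fun x y hxy => ?_⟩
      rw [map_mul, h x y hxy]
      simp
      linear_combination eval x q * hxy
    · refine ⟨p, q, fun x y hxy => ?_⟩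
      rw [map_mul, h x y hxy]
      simp

-- The point `O` is a limit of affine points: for points `(n, y n)` of the curve, `[n / y n : 1 : 1
-- / y n]` tends to `[0 : 1 : 0]` because `y n ^ 2` grows like `n ^ 3`. Homogeneity and continuity
-- carry the vanishing of `H` to the limit.
open Filter Topology in
lemma eval_infty_eq_zero (a b : ℂ) {H : MvPolynomial (Fin 3) ℂ} {d : ℕ} (hH : H.IsHomogeneous d)
    (h0 : ∀ x y : ℂ, y ^ 2 = x ^ 3 + a * x ^ 2 + b * x → MvPolynomial.eval ![x, y, 1] H = 0) :
    MvPolynomial.eval ![0, 1, 0] H = 0 := by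
  have hy : ∀ n : ℕ, ∃ y : ℂ, y ^ 2 = (n : ℂ) ^ 3 + a * (n : ℂ) ^ 2 + b * (n : ℂ) := fun n =>
    IsAlgClosed.exists_pow_nat_eq _ (n := 2) (by norm_num)
  choose y hy using hy
  have hr : Tendsto (fun n : ℕ => ((n : ℂ))⁻¹) atTop (𝓝 0) := tendsto_inv_atTop_nhds_zero_nat
  have hden : Tendsto (fun n : ℕ => 1 + a * ((n : ℂ))⁻¹ + b * ((n : ℂ))⁻¹ ^ 2) atTop (𝓝 1) := by
    have := ((hr.const_mul a).const_add 1).add ((hr.pow 2).const_mul b)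
    simpa using this
  have hev : ∀ᶠ n : ℕ in atTop, 1 + a * ((n : ℂ))⁻¹ + b * ((n : ℂ))⁻¹ ^ 2 ≠ 0 :=
    hden.eventually_ne one_ne_zero
  have husq : Tendsto (fun n : ℕ => ((n : ℂ) / y n) ^ 2) atTop (𝓝 0) := by
    have h1 : Tendsto (fun n : ℕ => ((n : ℂ))⁻¹ / (1 + a * ((n : ℂ))⁻¹ + b * ((n : ℂ))⁻¹ ^ 2))
        atTop (𝓝 0) := by
      have := hr.div hden one_ne_zero
      rwa [zero_div] at this
    refine h1.congr' ?_
    filter_upwards [eventually_ne_atTop 0] with n hn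
    have hn' : (n : ℂ) ≠ 0 := by exact_mod_cast hn
    rw [div_pow, hy]
    field_simp
  have hu : Tendsto (fun n : ℕ => (n : ℂ) / y n) atTop (𝓝 0) := by
    rw [tendsto_zero_iff_norm_tendsto_zero] at husq ⊢
    have := husq.sqrt
    simp only [norm_pow, Real.sqrt_sq (norm_nonneg _), Real.sqrt_zero] at this
    exact this
  have hw : Tendsto (fun n : ℕ => 1 / y n) atTop (𝓝 0) := by
    have := hu.mul hr
    rw [mul_zero] at this
    refine this.congr' ?_
    filter_upwards [eventually_ne_atTop 0] with n hn
    have hn' : (n : ℂ) ≠ 0 := by exact_mod_cast hn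
    field_simp
  have hv : Tendsto (fun n : ℕ => (![(n : ℂ) / y n, 1, 1 / y n] : Fin 3 → ℂ)) atTop
      (𝓝 ![0, 1, 0]) := by
    rw [tendsto_pi_nhds]
    intro i
    fin_cases i
    · simpa using hu
    · simp
    · simpa using hw
  have hlim := ((MvPolynomial.continuous_eval H).tendsto ![0, 1, 0]).comp hv
  refine tendsto_nhds_unique hlim (tendsto_const_nhds.congr' ?_)
  filter_upwards [hev, eventually_ne_atTop 0] with n hn hn0
  have hn' : (n : ℂ) ≠ 0 := by exact_mod_cast hn0
  have hyn : y n ≠ 0 := by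
    intro h1
    apply hn
    have h2 := hy n
    rw [h1] at h2
    have h3 : (n : ℂ) ^ 3 * (1 + a * ((n : ℂ))⁻¹ + b * ((n : ℂ))⁻¹ ^ 2) = 0 := by
      field_simp
      linear_combination -h2
    exact (mul_eq_zero.mp h3).resolve_left (pow_ne_zero _ hn')
  simp only [Function.comp]
  have h4 := hH.eval_const_mul (1 / y n) ![(n : ℂ), y n, 1]
  rw [h0 _ _ (hy n), mul_zero] at h4
  rw [← h4]
  congr 2
  ext i
  fin_cases i <;> simp [hyn, div_eq_inv_mul]

/-- Write `H = p(x) + y q(x)` on the affine curve. Infinitely many zeros have infinitely many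
abscissas, all of them roots of the norm `p² - (x³ + a x² + b x) q²`, so the norm vanishes and `p =
q = 0`. -/
lemma eval_eq_zero_of_infinite {H : MvPolynomial (Fin 3) ℂ} {d : ℕ} (hH : H.IsHomogeneous d)
    (hinf : {P : (twoTorsionCurve a b).toAffine.Point |
      MvPolynomial.eval (curveCoord _ P) H = 0}.Infinite)
    (P : (twoTorsionCurve a b).toAffine.Point) : MvPolynomial.eval (curveCoord _ P) H = 0 := by
  obtain ⟨p, q, hpq⟩ := exists_eval_eq a b H
  have hN : p ^ 2 - (X ^ 3 + C a * X ^ 2 + C b * X) * q ^ 2 = 0 := by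
    by_contra hne
    apply hinf
    refine Set.Finite.subset (Set.Finite.preimage' (f := xMap (twoTorsionCurve a b))
      ((Set.finite_singleton OnePoint.infty).union
        (((p ^ 2 - (X ^ 3 + C a * X ^ 2 + C b * X) * q ^ 2).roots.toFinset.finite_toSet).image
          fun z : ℂ => (z : OnePoint ℂ))) fun z _ => xMap_fibre_finite z) fun Q hQ => ?_
    rcases eq_zero_or_eq_pt Q with rfl | ⟨x, y, hxy, rfl⟩
    · left; rfl
    · right
      refine ⟨x, ?_, rfl⟩
      have h1 : p.eval x + y * q.eval x = 0 := by
        rw [← hpq x y hxy]; exact hQ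
      simp only [Finset.mem_coe, Multiset.mem_toFinset, mem_roots hne, IsRoot, eval_sub, eval_mul,
        eval_pow, eval_add, eval_X, eval_C]
      rw [← hxy]
      linear_combination (p.eval x - y * q.eval x) * h1
  obtain ⟨rfl, rfl⟩ := eq_zero_of_norm_eq_zero (sub_eq_zero.mp hN)
  have hfin : ∀ x y : ℂ, y ^ 2 = x ^ 3 + a * x ^ 2 + b * x → MvPolynomial.eval ![x, y, 1] H = 0 := by
    intro x y hxy
    simpa using hpq x y hxy
  rcases eq_zero_or_eq_pt P with rfl | ⟨x, y, hxy, rfl⟩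
  · exact eval_infty_eq_zero a b hH hfin
  · exact hfin x y hxy

/-- Morphisms to the sphere that agree at infinitely many points are equal. -/
lemma eq_of_infinite {f g : (twoTorsionCurve a b).toAffine.Point → OnePoint ℂ}
    (hf : IsMorphism (curveCoord _) sphereCoord f) (hg : IsMorphism (curveCoord _) sphereCoord g)
    (hinf : {P | f P = g P}.Infinite) : f = g := by
  funext P
  obtain ⟨d, F, hF, hFP, hFQ⟩ := hf P
  obtain ⟨e, G, hG, hGP, hGQ⟩ := hg P
  have hFv : ∀ Q, (∃ i, MvPolynomial.eval (curveCoord _ Q) (F i) ≠ 0) → f Q =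
      sphereMk (MvPolynomial.eval (curveCoord _ Q) (F 0)) (MvPolynomial.eval (curveCoord _ Q) (F 1)) :=
    fun Q hQ => (exists_sphereCoord_eq_iff hQ).mp (hFQ Q hQ)
  have hGv : ∀ Q, (∃ i, MvPolynomial.eval (curveCoord _ Q) (G i) ≠ 0) → g Q =
      sphereMk (MvPolynomial.eval (curveCoord _ Q) (G 0)) (MvPolynomial.eval (curveCoord _ Q) (G 1)) :=
    fun Q hQ => (exists_sphereCoord_eq_iff hQ).mp (hGQ Q hQ)
  -- This determinant vanishes where `f` and `g` agree, and trivially where one of the two local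
  -- formulas degenerates, so it has infinitely many zeros.
  have hH : (F 0 * G 1 - F 1 * G 0).IsHomogeneous (d + e) := ((hF 0).mul (hG 1)).sub ((hF 1).mul (hG 0))
  have key := eval_eq_zero_of_infinite hH (hinf.mono fun Q hQ => ?_) P
  · rw [hFv P hFP, hGv P hGP, sphereMk_eq_iff (Fin.exists_fin_two.mp hFP) (Fin.exists_fin_two.mp hGP)]
    simpa [sub_eq_zero] using key
  · by_cases h1 : ∃ i, MvPolynomial.eval (curveCoord _ Q) (F i) ≠ 0
    · by_cases h2 : ∃ i, MvPolynomial.eval (curveCoord _ Q) (G i) ≠ 0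
      · have hQ' : f Q = g Q := hQ
        rw [hFv Q h1, hGv Q h2, sphereMk_eq_iff (Fin.exists_fin_two.mp h1)
          (Fin.exists_fin_two.mp h2)] at hQ'
        simpa [sub_eq_zero] using hQ'
      · push Not at h2
        simp [h2]
    · push Not at h1
      simp [h1]

lemma isMorphism_xMap : IsMorphism (curveCoord (twoTorsionCurve a b)) sphereCoord
    (xMap (twoTorsionCurve a b)) := by
  intro P
  rcases eq_zero_or_eq_pt P with rfl | ⟨x, y, hxy, rfl⟩
  -- At `O` the formula `[x : z]` is `[0 : 0]`. The equation `z (y² - a x² - b x z) = x³` gives `[x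
  -- : z] = [y² - a x² - b x z : x²]`.
  · refine ⟨2, ![.X 1 ^ 2 - .C a * .X 0 * .X 0 - .C b * .X 0 * .X 2, .X 0 ^ 2], ?_, ⟨0, ?_⟩, ?_⟩
    · intro i
      fin_cases i
      · exact ((MvPolynomial.isHomogeneous_X_pow 1 2).sub
          ((MvPolynomial.isHomogeneous_C_mul_X a 0).mul (MvPolynomial.isHomogeneous_X _ 0))).sub
          ((MvPolynomial.isHomogeneous_C_mul_X b 0).mul (MvPolynomial.isHomogeneous_X _ 2))
      · exact MvPolynomial.isHomogeneous_X_pow 0 2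
    · change MvPolynomial.eval ![0, 1, 0] _ ≠ 0
      simp
    · intro Q hQ
      rw [exists_sphereCoord_eq_iff hQ]
      rcases eq_zero_or_eq_pt Q with rfl | ⟨x, y, hxy, rfl⟩
      · change _ = sphereMk (MvPolynomial.eval ![0, 1, 0] _) (MvPolynomial.eval ![0, 1, 0] _)
        simp [sphereMk_zero]
      · change ∃ i, MvPolynomial.eval ![x, y, 1] _ ≠ 0 at hQ
        rw [Fin.exists_fin_two] at hQ
        change _ = sphereMk (MvPolynomial.eval ![x, y, 1] _) (MvPolynomial.eval ![x, y, 1] _)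
        simp at hQ
        simp only [xMap_pt, Matrix.cons_val_zero, Matrix.cons_val_one]
        rw [eq_comm, sphereMk_eq_coe]
        simp
        have hx : x ≠ 0 := by
          rintro rfl
          simp at hxy
          simp [hxy] at hQ
        exact ⟨hx, by linear_combination hxy⟩
  · refine ⟨1, ![.X 0, .X 2], ?_, ⟨1, ?_⟩, ?_⟩
    · intro i
      fin_cases i <;> exact MvPolynomial.isHomogeneous_X _ _
    · change MvPolynomial.eval ![x, y, 1] _ ≠ 0
      simp
    · intro Q hQ
      rw [exists_sphereCoord_eq_iff hQ]
      rcases eq_zero_or_eq_pt Q with rfl | ⟨x, y, hxy, rfl⟩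
      · exfalso
        change ∃ i, MvPolynomial.eval ![0, 1, 0] _ ≠ 0 at hQ
        simp [Fin.exists_fin_two] at hQ
      · change _ = sphereMk (MvPolynomial.eval ![x, y, 1] _) (MvPolynomial.eval ![x, y, 1] _)
        simp [sphereMk_one]

/-- Finitely many points of the sphere have a fibre of the `x`-coordinate not of the form
`{P, -P}` with `P ≠ -P`. -/
lemma finite_branch : {z : OnePoint ℂ | ∃ P : (twoTorsionCurve a b).toAffine.Point,
    xMap _ P = z ∧ P = -P}.Finite := by
  have hne : (X ^ 3 + C a * X ^ 2 + C b * X : ℂ[X]) ≠ 0 := by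
    have hdeg : (X ^ 3 + C a * X ^ 2 + C b * X : ℂ[X]).natDegree = 3 := by compute_degree!
    intro h0
    rw [h0] at hdeg
    simp at hdeg
  refine ((Set.finite_singleton OnePoint.infty).union
    (((X ^ 3 + C a * X ^ 2 + C b * X : ℂ[X]).roots.toFinset.finite_toSet).image
      fun z : ℂ => (z : OnePoint ℂ))).subset ?_
  rintro z ⟨P, rfl, hP⟩
  rcases eq_zero_or_eq_pt P with rfl | ⟨x, y, hxy, rfl⟩
  · left; rfl
  · right
    refine ⟨x, ?_, rfl⟩
    rw [neg_pt, pt_inj, self_eq_neg] at hP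
    simp only [Finset.mem_coe, Multiset.mem_toFinset, mem_roots hne, IsRoot, eval_mul,
        eval_pow, eval_add, eval_X, eval_C]
    rw [← hxy, hP.2]
    ring

lemma isEvenDoubleCover_xMap : IsEvenDoubleCover (twoTorsionCurve a b) (xMap _) := by
  refine ⟨isMorphism_xMap, (finite_branch (a := a) (b := b)).subset fun z hz => ?_, xMap_neg⟩
  obtain ⟨P, rfl⟩ := xMap_surjective (a := a) (b := b) z
  refine ⟨P, rfl, ?_⟩
  by_contra hne
  apply hz
  have : xMap (twoTorsionCurve a b) ⁻¹' {xMap _ P} = {P, -P} := by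
    ext Q
    simp [xMap_eq_iff]
  rw [this, Set.ncard_pair hne]

lemma infinite_setOf_ne {r : ℂ[X]} (hr : r ≠ 0) :
    {P : (twoTorsionCurve a b).toAffine.Point | ∃ x y hxy, P = pt x y hxy ∧ y ≠ 0 ∧ r.eval x ≠ 0}.Infinite := by
  intro hfin
  have h1 := hfin.image (xMap _)
  have hne : (r * (X ^ 3 + C a * X ^ 2 + C b * X) : ℂ[X]) ≠ 0 := by
    have hdeg : (X ^ 3 + C a * X ^ 2 + C b * X : ℂ[X]).natDegree = 3 := by compute_degree!
    refine mul_ne_zero hr fun h0 => ?_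
    rw [h0] at hdeg
    simp at hdeg
  have h2 := h1.union (((r * (X ^ 3 + C a * X ^ 2 + C b * X) : ℂ[X]).roots.toFinset.finite_toSet).image
      fun z : ℂ => (z : OnePoint ℂ))
  have h3 : (Set.range fun z : ℂ => (z : OnePoint ℂ)).Infinite :=
    Set.infinite_range_of_injective OnePoint.coe_injective
  apply h3
  refine h2.subset ?_
  rintro _ ⟨x, rfl⟩
  by_cases hx : (r * (X ^ 3 + C a * X ^ 2 + C b * X) : ℂ[X]).eval x = 0
  · right
    exact ⟨x, by simp only [Finset.mem_coe, Multiset.mem_toFinset, mem_roots hne, IsRoot]; exact hx, rfl⟩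
  · left
    obtain ⟨y, hy⟩ := IsAlgClosed.exists_pow_nat_eq (x ^ 3 + a * x ^ 2 + b * x) (n := 2) (by norm_num)
    refine ⟨pt x y hy, ⟨x, y, hy, rfl, ?_, ?_⟩, rfl⟩
    · rintro rfl
      apply hx
      simp only [eval_mul, eval_pow, eval_add, eval_X, eval_C]
      rw [← hy]
      ring
    · intro h0
      simp [h0] at hx

/-- Every even morphism to the sphere is a rational function of the `x`-coordinate. -/
lemma exists_eq_comp_xMap {π : (twoTorsionCurve a b).toAffine.Point → OnePoint ℂ}
    (hπ : IsMorphism (curveCoord _) sphereCoord π) (heven : ∀ P, π (-P) = π P) :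
    ∃ g, IsRationalMap g ∧ π = g ∘ xMap _ := by
  -- The local formula is taken at `(0, 0)` because `y = 0` there: its nonvanishing says that some
  -- `p i` is nonzero at `0`, so `[p 0 : p 1]` defines a rational function.
  obtain ⟨d, F, hF, hF0, hFQ⟩ := hπ (pt 0 0 (by ring))
  have hFv : ∀ Q, (∃ i, MvPolynomial.eval (curveCoord _ Q) (F i) ≠ 0) → π Q =
      sphereMk (MvPolynomial.eval (curveCoord _ Q) (F 0)) (MvPolynomial.eval (curveCoord _ Q) (F 1)) :=
    fun Q hQ => (exists_sphereCoord_eq_iff hQ).mp (hFQ Q hQ)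
  choose p q hpq using fun i => exists_eval_eq a b (F i)
  have hp : p 0 ≠ 0 ∨ p 1 ≠ 0 := by
    rw [← Fin.exists_fin_two (p := fun i => p i ≠ 0)]
    obtain ⟨i, hi⟩ := hF0
    refine ⟨i, fun h0 => hi ?_⟩
    have := hpq i 0 0 (by ring)
    rw [h0] at this
    change MvPolynomial.eval ![0, 0, 1] (F i) = 0
    simpa using this
  obtain ⟨g, hg, hgv⟩ := exists_isRationalMap (p 0) (p 1) hp
  refine ⟨g, hg, eq_of_infinite hπ (hg.comp_isMorphism isMorphism_xMap) ?_⟩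
  obtain ⟨r, hr, hrv⟩ : ∃ r : ℂ[X], r ≠ 0 ∧ ∀ x, r.eval x ≠ 0 → (p 0).eval x ≠ 0 ∨ (p 1).eval x ≠ 0 := by
    rcases hp with h | h
    · exact ⟨_, h, fun x hx => Or.inl hx⟩
    · exact ⟨_, h, fun x hx => Or.inr hx⟩
  refine (infinite_setOf_ne (a := a) (b := b) hr).mono ?_
  rintro P ⟨x, y, hxy, rfl, hy, hx⟩
  have hpx := hrv x hx
  have hxy' : (-y) ^ 2 = x ^ 3 + a * x ^ 2 + b * x := by rw [neg_sq, hxy]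
  have e1 : ∀ i, MvPolynomial.eval (curveCoord _ (pt x y hxy)) (F i) =
    (p i).eval x + y * (q i).eval x := fun i => hpq i x y hxy
  have e2 : ∀ i, MvPolynomial.eval (curveCoord _ (pt x (-y) hxy')) (F i) =
    (p i).eval x + -y * (q i).eval x := fun i => hpq i x (-y) hxy'
  have hev : π (pt x (-y) hxy') = π (pt x y hxy) := by rw [← neg_pt, heven]
  change π (pt x y hxy) = g (x : OnePoint ℂ)
  rw [hgv x hpx]
  have v1 := hFv (pt x y hxy)
  have v2 := hFv (pt x (-y) hxy')
  rw [Fin.exists_fin_two] at v1 v2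
  simp only [e1, e2] at v1 v2
  generalize (p 0).eval x = s at *
  generalize (p 1).eval x = t at *
  generalize (q 0).eval x = u at *
  generalize (q 1).eval x = v at *
  -- Evenness equates `[s + y u : t + y v]` and `[s - y u : t - y v]`, hence `y (u t - v s) = 0` and
  -- both are `[s : t]`. If one pair is `(0, 0)`, the other is twice `(s, t)`.
  by_cases h1 : s + y * u ≠ 0 ∨ t + y * v ≠ 0
  · rw [v1 h1, sphereMk_eq_iff h1 hpx]
    by_cases h2 : s + -y * u ≠ 0 ∨ t + -y * v ≠ 0
    · rw [v1 h1, v2 h2, sphereMk_eq_iff h2 h1] at hev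
      have : y * (u * t - v * s) = 0 := by linear_combination -hev / 2
      linear_combination this
    · push Not at h2
      linear_combination -t * h2.1 + s * h2.2
  · push Not at h1
    have h2 : s + -y * u ≠ 0 ∨ t + -y * v ≠ 0 := by
      by_contra! h2
      rcases hpx with h | h
      · apply h; linear_combination (h1.1 + h2.1) / 2
      · apply h; linear_combination (h1.2 + h2.2) / 2
    rw [← hev, v2 h2, sphereMk_eq_iff h2 hpx]
    linear_combination -t * h1.1 + s * h1.2

/-- Even double covers are the `x`-coordinate up to a Möbius transformation. -/
lemma exists_mobius_of_cover {π : (twoTorsionCurve a b).toAffine.Point → OnePoint ℂ}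
    (hπ : IsEvenDoubleCover (twoTorsionCurve a b) π) :
    ∃ μ : OnePoint ℂ ≃ OnePoint ℂ, IsMobius μ ∧ π = μ ∘ xMap _ := by
  obtain ⟨g, hg, rfl⟩ := exists_eq_comp_xMap hπ.morphism hπ.even
  obtain ⟨d, p, q, hpq⟩ := isRationalMap_iff.mp hg
  -- Over a general `t` the fibre of `g ∘ x` has two points and contains `P ≠ -P`; these have the
  -- same abscissa, so the fibre of `g` is a single point.
  have hd : d = 1 := by
    refine hpq.degree_eq (hπ.degree_two.union (finite_branch (a := a) (b := b) |>.image g))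
      fun t ht => ?_
    simp only [Set.mem_union, Set.mem_ofPred_eq, not_or, not_not] at ht
    obtain ⟨h2, hB⟩ := ht
    obtain ⟨P, hP⟩ : ((g ∘ xMap (twoTorsionCurve a b)) ⁻¹' {t}).Nonempty := by
      rw [← Set.ncard_pos (Set.finite_of_ncard_ne_zero (by omega))]
      omega
    have hP' : g (xMap _ P) = t := hP
    have hne : P ≠ -P := fun e => hB ⟨_, ⟨P, rfl, e⟩, hP'⟩
    have heq : {P, -P} = (g ∘ xMap (twoTorsionCurve a b)) ⁻¹' {t} := by
      apply Set.eq_of_subset_of_ncard_le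
      · rintro Q (rfl | rfl)
        · exact hP
        · simpa [xMap_neg] using hP'
      · rw [h2, Set.ncard_pair hne]
      · exact Set.finite_of_ncard_ne_zero (by omega)
    rw [Set.ncard_eq_one]
    refine ⟨xMap _ P, ?_⟩
    ext z
    simp only [Set.mem_preimage, Set.mem_singleton_iff]
    constructor
    · intro hz
      obtain ⟨Q, rfl⟩ := xMap_surjective (a := a) (b := b) z
      have : Q ∈ ({P, -P} : Set _) := heq ▸ hz
      exact xMap_eq_iff.mpr this
    · rintro rfl
      exact hP'
  subst hd
  obtain ⟨s, rfl⟩ := hpq.exists_smul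
  exact ⟨_, isMobius_toPerm s, rfl⟩

end twoTorsionCurve

/-! ### Isomorphisms of curves and changes of Weierstrass variables -/

/-- Isomorphisms of elliptic curves. -/
structure CurveIso (W W' : WeierstrassCurve ℂ) where
  toAddEquiv : W.toAffine.Point ≃+ W'.toAffine.Point
  morphism : IsMorphism (curveCoord W) (curveCoord W') toAddEquiv
  morphism_symm : IsMorphism (curveCoord W') (curveCoord W) toAddEquiv.symm

namespace CurveIso

def symm {W W' : WeierstrassCurve ℂ} (e : CurveIso W W') : CurveIso W' W :=
  ⟨e.toAddEquiv.symm, e.morphism_symm, e.morphism⟩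

def trans {W W' W'' : WeierstrassCurve ℂ} (e : CurveIso W W') (e' : CurveIso W' W'') :
    CurveIso W W'' :=
  ⟨e.toAddEquiv.trans e'.toAddEquiv, e'.morphism.comp e.morphism (curveCoord_ne_zero _),
    e.morphism_symm.comp e'.morphism_symm (curveCoord_ne_zero _)⟩

end CurveIso

/-- The Weierstrass equations of `W` and `W'` are related by the change of variables
`x' = x - r`, `y' = y - s (x - r) - t`. -/
structure IsShift (W W' : WeierstrassCurve ℂ) (r s t : ℂ) : Prop where
  a₁ : W'.a₁ = W.a₁ + 2 * s
  a₂ : W'.a₂ = W.a₂ - s * W.a₁ + 3 * r - s ^ 2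
  a₃ : W'.a₃ = W.a₃ + r * W.a₁ + 2 * t
  a₄ : W'.a₄ = W.a₄ - s * W.a₃ + 2 * r * W.a₂ - (t + r * s) * W.a₁ + 3 * r ^ 2 - 2 * s * t
  a₆ : W'.a₆ = W.a₆ + r * W.a₄ + r ^ 2 * W.a₂ + r ^ 3 - t * W.a₃ - t ^ 2 - r * t * W.a₁

namespace IsShift

variable {W W' : WeierstrassCurve ℂ} {r s t : ℂ}

lemma symm (h : IsShift W W' r s t) : IsShift W' W (-r) (-s) (r * s - t) := by
  constructor
  · rw [h.a₁]; ring
  · rw [h.a₁, h.a₂]; ring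
  · rw [h.a₁, h.a₃]; ring
  · rw [h.a₁, h.a₂, h.a₃, h.a₄]; ring
  · rw [h.a₁, h.a₂, h.a₃, h.a₄, h.a₆]; ring

lemma eq_smul (h : IsShift W W' r s t) : W' = (⟨1, r, s, t⟩ : WeierstrassCurve.VariableChange ℂ) • W := by
  ext
  · simp [WeierstrassCurve.variableChange_a₁, h.a₁]
  · simp [WeierstrassCurve.variableChange_a₂, h.a₂]
  · simp [WeierstrassCurve.variableChange_a₃, h.a₃]
  · simp [WeierstrassCurve.variableChange_a₄, h.a₄]
  · simp [WeierstrassCurve.variableChange_a₆, h.a₆]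

lemma isElliptic [W.IsElliptic] (h : IsShift W W' r s t) : W'.IsElliptic := by
  rw [h.eq_smul]; infer_instance

lemma j_eq [W.IsElliptic] [W'.IsElliptic] (h : IsShift W W' r s t) : W'.j = W.j := by
  obtain rfl := h.eq_smul
  exact WeierstrassCurve.variableChange_j _ _

lemma equation (h : IsShift W W' r s t) {x y : ℂ} (hxy : W.toAffine.Equation x y) :
    W'.toAffine.Equation (x - r) (y - s * (x - r) - t) := by
  rw [Affine.equation_iff] at hxy ⊢
  simp only [h.a₁, h.a₂, h.a₃, h.a₄, h.a₆]
  linear_combination hxy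

lemma negY (h : IsShift W W' r s t) (x y : ℂ) : W'.toAffine.negY (x - r) (y - s * (x - r) - t) =
    W.toAffine.negY x y - s * (x - r) - t := by
  simp only [Affine.negY, h.a₁, h.a₃]
  ring

lemma slope (h : IsShift W W' r s t) {x₁ x₂ y₁ y₂ : ℂ}
    (h₁ : W.toAffine.Equation x₁ y₁) (h₂ : W.toAffine.Equation x₂ y₂)
    (hxy : ¬(x₁ = x₂ ∧ y₁ = W.toAffine.negY x₂ y₂)) :
    W'.toAffine.slope (x₁ - r) (x₂ - r) (y₁ - s * (x₁ - r) - t) (y₂ - s * (x₂ - r) - t) =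
      W.toAffine.slope x₁ x₂ y₁ y₂ - s := by
  by_cases hx : x₁ = x₂
  · subst hx
    have hy : y₁ ≠ W.toAffine.negY x₁ y₂ := fun e => hxy ⟨rfl, e⟩
    obtain rfl := Affine.Y_eq_of_Y_ne h₁ h₂ rfl hy
    have hy' : y₁ - s * (x₁ - r) - t ≠ W'.toAffine.negY (x₁ - r) (y₁ - s * (x₁ - r) - t) := by
      rw [h.negY]
      intro e
      apply hy
      linear_combination e
    have hd : y₁ - W.toAffine.negY x₁ y₁ ≠ 0 := sub_ne_zero.mpr hy
    rw [Affine.slope_of_Y_ne rfl hy, Affine.slope_of_Y_ne rfl hy', h.negY]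
    have e : y₁ - s * (x₁ - r) - t - (W.toAffine.negY x₁ y₁ - s * (x₁ - r) - t) =
      y₁ - W.toAffine.negY x₁ y₁ := by ring
    rw [e, div_eq_iff hd, sub_mul, div_mul_cancel₀ _ hd]
    simp only [h.a₁, h.a₂, h.a₄, Affine.negY]
    ring
  · have hx' : x₁ - r ≠ x₂ - r := fun e => hx (by linear_combination e)
    have hd : x₁ - x₂ ≠ 0 := sub_ne_zero.mpr hx
    have e : x₁ - r - (x₂ - r) = x₁ - x₂ := by ring
    rw [Affine.slope_of_X_ne hx, Affine.slope_of_X_ne hx', e, div_eq_iff hd, sub_mul,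
      div_mul_cancel₀ _ hd]
    ring

variable [W.IsElliptic] [W'.IsElliptic]

/-- The change of variables, on points. -/
def map (h : IsShift W W' r s t) : W.toAffine.Point → W'.toAffine.Point
  | .zero => .zero
  | .some x y hxy => .some (x - r) (y - s * (x - r) - t)
      (Affine.equation_iff_nonsingular.mp (h.equation hxy.1))

lemma map_add (h : IsShift W W' r s t) (P Q : W.toAffine.Point) :
    h.map (P + Q) = h.map P + h.map Q := by
  rcases P with _ | ⟨x₁, y₁, h₁⟩
  · change h.map (0 + Q) = 0 + h.map Q
    rw [zero_add, zero_add]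
  rcases Q with _ | ⟨x₂, y₂, h₂⟩
  · change h.map (_ + 0) = _ + 0
    rw [add_zero, add_zero]
  by_cases hxy : x₁ = x₂ ∧ y₁ = W.toAffine.negY x₂ y₂
  · rw [Affine.Point.add_of_Y_eq hxy.1 hxy.2]
    refine (Affine.Point.add_of_Y_eq ?_ ?_).symm
    · rw [hxy.1]
    · rw [h.negY, hxy.1, hxy.2]
  · have hxy' : ¬(x₁ - r = x₂ - r ∧ y₁ - s * (x₁ - r) - t =
        W'.toAffine.negY (x₂ - r) (y₂ - s * (x₂ - r) - t)) := by
      rw [h.negY]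
      rintro ⟨e1, e2⟩
      have e : x₁ = x₂ := by linear_combination e1
      refine hxy ⟨e, ?_⟩
      rw [e] at e2
      linear_combination e2
    rw [Affine.Point.add_some hxy]
    simp only [map]
    rw [Affine.Point.add_some hxy', Affine.Point.some.injEq, h.slope h₁.1 h₂.1 hxy]
    simp only [Affine.addX, Affine.addY, Affine.negAddY, Affine.negY, h.a₁, h.a₂, h.a₃]
    constructor <;> ring

lemma map_map (h : IsShift W W' r s t) (P : W.toAffine.Point) : h.symm.map (h.map P) = P := by
  rcases P with _ | ⟨x₁, y₁, h₁⟩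
  · rfl
  · simp only [map, Affine.Point.some.injEq]
    constructor <;> ring

lemma isMorphism (h : IsShift W W' r s t) : IsMorphism (curveCoord W) (curveCoord W') h.map := by
  intro P
  refine ⟨1, ![.X 0 - .C r * .X 2, .X 1 - .C s * .X 0 + .C (r * s - t) * .X 2, .X 2], ?_, ?_, ?_⟩
  · intro i
    fin_cases i
    · exact (MvPolynomial.isHomogeneous_X _ 0).sub (MvPolynomial.isHomogeneous_C_mul_X r 2)
    · exact ((MvPolynomial.isHomogeneous_X _ 1).sub (MvPolynomial.isHomogeneous_C_mul_X s 0)).add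
        (MvPolynomial.isHomogeneous_C_mul_X _ 2)
    · exact MvPolynomial.isHomogeneous_X _ 2
  · rcases P with _ | ⟨x, y, hxy⟩
    · exact ⟨1, by simp [curveCoord]⟩
    · exact ⟨2, by simp [curveCoord]⟩
  · intro Q _
    refine ⟨1, ?_⟩
    rcases Q with _ | ⟨x, y, hxy⟩
    · ext i; fin_cases i <;> simp [curveCoord, map]
    · ext i
      fin_cases i
      · simp [curveCoord, map]
      · simp [curveCoord, map]; ring
      · simp [curveCoord, map]

/-- The change of variables, as an isomorphism. -/
def curveIso (h : IsShift W W' r s t) : CurveIso W W' where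
  toAddEquiv :=
    { toFun := h.map
      invFun := h.symm.map
      left_inv := h.map_map
      right_inv := fun P => by
        rcases P with _ | ⟨x₁, y₁, h₁⟩
        · rfl
        · simp only [map, Affine.Point.some.injEq]
          constructor <;> ring
      map_add' := h.map_add }
  morphism := h.isMorphism
  morphism_symm := h.symm.isMorphism

end IsShift

/-! ### The explicit isogeny with kernel generated by `(0, 0)`, and its dual -/

namespace twoTorsionCurve

/-- The `x`-coordinate of the isogeny with kernel `{0, (0, 0)}`. -/
def isogX (a b c : ℂ) (z : OnePoint ℂ) : OnePoint ℂ :=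
  z.elim OnePoint.infty fun x => sphereMk (c ^ 2 * (x ^ 2 + a * x + b)) x

lemma isogX_coe (a b c x : ℂ) :
    isogX a b c (x : OnePoint ℂ) = sphereMk (c ^ 2 * (x ^ 2 + a * x + b)) x := rfl

lemma isogX_infty (a b c : ℂ) : isogX a b c OnePoint.infty = OnePoint.infty := rfl

lemma isRatPair_isogX {a b c : ℂ} (hb : b ≠ 0) (hc : c ≠ 0) :
    IsRatPair 2 (C (c ^ 2) * (X ^ 2 + C a * X + C b)) X (isogX a b c) := by
  refine ⟨by compute_degree!, by simp, ?_, ?_, ?_, ?_⟩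
  · rw [isCoprime_iff_eval_ne_zero]
    intro z
    by_cases hz : z = 0
    · left; simp [hz, hb, hc]
    · right; simpa using hz
  · left
    rw [coeff_C_mul]
    simp [hc]
  · intro z
    simp [isogX_coe]
  · rw [isogX_infty, eq_comm, sphereMk_eq_infty, coeff_X]
    simp

lemma isRationalMap_isogX {a b c : ℂ} (hb : b ≠ 0) (hc : c ≠ 0) : IsRationalMap (isogX a b c) :=
  isRationalMap_iff.mpr ⟨_, _, _, isRatPair_isogX hb hc⟩

lemma isogX_surjective {a b c : ℂ} (hb : b ≠ 0) (hc : c ≠ 0) : Function.Surjective (isogX a b c) :=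
  (isRatPair_isogX hb hc).surjective two_ne_zero

/-- This is the classical isogeny `(y² / x², y (b - x²) / x²)` onto `y² = x³ - 2 a x² + (a² - 4 b)
x`, followed by the scaling `(x, y) ↦ (c² x, c³ y)`. The parameter `c` lets one family contain both
the isogeny (`c = 1`) and its dual (`c = 1 / 2`, which leads back to the original coefficients). -/
lemma isog_equation {a b A B c : ℂ} (hA : A = -2 * a * c ^ 2) (hB : B = (a ^ 2 - 4 * b) * c ^ 4)
    {x y : ℂ} (hx : x ≠ 0) (hxy : y ^ 2 = x ^ 3 + a * x ^ 2 + b * x) :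
    (c ^ 3 * y * (b - x ^ 2) / x ^ 2) ^ 2 = (c ^ 2 * y ^ 2 / x ^ 2) ^ 3 +
      A * (c ^ 2 * y ^ 2 / x ^ 2) ^ 2 + B * (c ^ 2 * y ^ 2 / x ^ 2) := by
  subst hA hB
  have : (c ^ 3 * y * (b - x ^ 2) / x ^ 2) ^ 2 = c ^ 6 * y ^ 2 * (b - x ^ 2) ^ 2 / x ^ 4 := by
    field_simp
  have h2 : (c ^ 2 * y ^ 2 / x ^ 2) = c ^ 2 * (x ^ 2 + a * x + b) / x := by
    rw [hxy]; field_simp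
  rw [this, h2, hxy]
  field_simp
  ring

section

variable {a b A B c c' : ℂ} [(twoTorsionCurve a b).IsElliptic] [(twoTorsionCurve A B).IsElliptic]

/-- The isogeny with kernel `{0, (0, 0)}`. -/
def isog (hA : A = -2 * a * c ^ 2) (hB : B = (a ^ 2 - 4 * b) * c ^ 4) :
    (twoTorsionCurve a b).toAffine.Point → (twoTorsionCurve A B).toAffine.Point
  | .zero => 0
  | .some x y hxy => if hx : x = 0 then 0 else
      pt (c ^ 2 * y ^ 2 / x ^ 2) (c ^ 3 * y * (b - x ^ 2) / x ^ 2)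
        (isog_equation hA hB hx (equation_iff.mp hxy.1))

variable (hA : A = -2 * a * c ^ 2) (hB : B = (a ^ 2 - 4 * b) * c ^ 4)

lemma isog_zero : isog hA hB 0 = 0 := rfl

lemma isog_pt_zero {y : ℂ} (hxy : y ^ 2 = (0 : ℂ) ^ 3 + a * 0 ^ 2 + b * 0) :
    isog hA hB (pt 0 y hxy) = 0 := by
  simp [isog, pt]

lemma isog_pt {x y : ℂ} (hxy : y ^ 2 = x ^ 3 + a * x ^ 2 + b * x) (hx : x ≠ 0) :
    isog hA hB (pt x y hxy) = pt (c ^ 2 * y ^ 2 / x ^ 2) (c ^ 3 * y * (b - x ^ 2) / x ^ 2)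
      (isog_equation hA hB hx hxy) := by
  simp [isog, pt, hx]

lemma isog_eq_zero_iff {P : (twoTorsionCurve a b).toAffine.Point} :
    isog hA hB P = 0 ↔ P = 0 ∨ P = pt 0 0 (by ring) := by
  constructor
  · intro h
    rcases eq_zero_or_eq_pt P with rfl | ⟨x, y, hxy, rfl⟩
    · exact Or.inl rfl
    · right
      by_cases hx : x = 0
      · subst hx
        exact pt_congr rfl (by simpa using hxy)
      · rw [isog_pt hA hB hxy hx] at h
        exact absurd h (pt_ne_zero _)
  · rintro (rfl | rfl)
    · rfl
    · exact isog_pt_zero hA hB _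

lemma xMap_isog (P : (twoTorsionCurve a b).toAffine.Point) :
    xMap _ (isog hA hB P) = isogX a b c (xMap _ P) := by
  rcases eq_zero_or_eq_pt P with rfl | ⟨x, y, hxy, rfl⟩
  · rfl
  · rw [xMap_pt, isogX_coe]
    by_cases hx : x = 0
    · subst hx
      rw [isog_pt_zero, sphereMk_zero, xMap_zero]
    · rw [isog_pt hA hB hxy hx, xMap_pt, sphereMk_of_ne hx, hxy]
      congr 1
      field_simp

lemma exists_curveCoord_pt {X Y l : ℂ} (hXY : Y ^ 2 = X ^ 3 + A * X ^ 2 + B * X) (hl : l ≠ 0)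
    {v : Fin 3 → ℂ} (h0 : v 0 = l * X) (h1 : v 1 = l * Y) (h2 : v 2 = l) :
    ∃ k : ℂ, curveCoord _ (pt X Y hXY) = fun i => k * v i := by
  refine ⟨l⁻¹, ?_⟩
  change ![X, Y, 1] = _
  ext i
  fin_cases i
  · simp [h0, hl]
  · simp [h1, hl]
  · simp [h2, hl]

lemma exists_curveCoord_zero (W : WeierstrassCurve ℂ) {v : Fin 3 → ℂ} (hv : ∃ i, v i ≠ 0)
    (h0 : v 0 = 0) (h2 : v 2 = 0) :
    ∃ k : ℂ, curveCoord W 0 = fun i => k * v i := by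
  have h1 : v 1 ≠ 0 := by
    obtain ⟨i, hi⟩ := hv
    fin_cases i
    · exact absurd h0 hi
    · exact hi
    · exact absurd h2 hi
  refine ⟨(v 1)⁻¹, ?_⟩
  change ![0, 1, 0] = _
  ext i
  fin_cases i
  · simp [h0]
  · simp [h1]
  · simp [h2]

/-- A triple of polynomials that is proportional to the affine formula of the isogeny, and that
gives the right value at `O` and `(0, 0)`, is a local formula for it. -/
lemma isog_chart {F : Fin 3 → MvPolynomial (Fin 3) ℂ}
    (h0 : MvPolynomial.eval ![0, 1, 0] (F 0) = 0 ∧ MvPolynomial.eval ![0, 1, 0] (F 2) = 0)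
    (h1 : MvPolynomial.eval ![0, 0, 1] (F 0) = 0 ∧ MvPolynomial.eval ![0, 0, 1] (F 2) = 0)
    (h : ∀ x y : ℂ, x ≠ 0 → y ^ 2 = x ^ 3 + a * x ^ 2 + b * x → ∃ l : ℂ,
      MvPolynomial.eval ![x, y, 1] (F 0) = l * (c ^ 2 * y ^ 2) ∧
      MvPolynomial.eval ![x, y, 1] (F 1) = l * (c ^ 3 * y * (b - x ^ 2)) ∧
      MvPolynomial.eval ![x, y, 1] (F 2) = l * x ^ 2)
    (Q : (twoTorsionCurve a b).toAffine.Point)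
    (hQ : ∃ i, MvPolynomial.eval (curveCoord _ Q) (F i) ≠ 0) :
    ∃ k : ℂ, curveCoord _ (isog hA hB Q) = fun i => k * MvPolynomial.eval (curveCoord _ Q) (F i) := by
  rcases eq_zero_or_eq_pt Q with rfl | ⟨x, y, hxy, rfl⟩
  · rw [isog_zero]
    exact exists_curveCoord_zero _ hQ h0.1 h0.2
  · by_cases hx : x = 0
    · subst hx
      obtain rfl : y = 0 := by simpa using hxy
      rw [isog_pt_zero]
      exact exists_curveCoord_zero _ hQ h1.1 h1.2
    · obtain ⟨l, e0, e1, e2⟩ := h x y hx hxy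
      rw [isog_pt hA hB hxy hx]
      have hl : l ≠ 0 := by
        rintro rfl
        obtain ⟨i, hi⟩ := hQ
        apply hi
        change MvPolynomial.eval ![x, y, 1] (F i) = 0
        fin_cases i
        · exact e0.trans (zero_mul _)
        · exact e1.trans (zero_mul _)
        · exact e2.trans (zero_mul _)
      refine exists_curveCoord_pt (l := l * x ^ 2) _ (mul_ne_zero hl (pow_ne_zero _ hx)) ?_ ?_ e2
      · refine e0.trans ?_; field_simp
      · refine e1.trans ?_; field_simp

/-- The triple `[c² y² z : c³ y (b z² - x²) : x² z]` vanishes at `O` and at `(0, 0)`. Multiplying it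
by `x / z` near `O`, and by `y / x` near `(0, 0)`, and simplifying with the equation of the curve
gives formulas that are regular and nonzero there; the middle coordinates are `-c³` and `c³ b²`. -/
lemma isMorphism_isog (hc : c ≠ 0) : IsMorphism (curveCoord _) (curveCoord _) (isog hA hB) := by
  have hb := b_ne_zero (a := a) (b := b) inferInstance
  have hX : ∀ i : Fin 3, (MvPolynomial.X i : MvPolynomial (Fin 3) ℂ).IsHomogeneous 1 :=
    fun i => MvPolynomial.isHomogeneous_X _ i
  have hXX : ∀ i : Fin 3, (MvPolynomial.X i ^ 2 : MvPolynomial (Fin 3) ℂ).IsHomogeneous 2 :=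
    fun i => MvPolynomial.isHomogeneous_X_pow i 2
  intro P
  rcases eq_zero_or_eq_pt P with rfl | ⟨x, y, hxy, rfl⟩
  · refine ⟨3, ![.C (c ^ 2) * (.X 1 ^ 2 * .X 0),
      .C (c ^ 3) * (.X 1 * (.C b * (.X 2 * .X 0) - (.X 1 ^ 2 - .C a * .X 0 ^ 2 - .C b * (.X 0 * .X 2)))),
      .X 2 * (.X 1 ^ 2 - .C a * .X 0 ^ 2 - .C b * (.X 0 * .X 2))], ?_, ⟨1, ?_⟩,
      isog_chart hA hB ?_ ?_ ?_⟩
    · have hD : (.X 1 ^ 2 - .C a * .X 0 ^ 2 - .C b * (.X 0 * .X 2) :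
          MvPolynomial (Fin 3) ℂ).IsHomogeneous 2 :=
        ((hXX 1).sub ((hXX 0).C_mul a)).sub (((hX 0).mul (hX 2)).C_mul b)
      intro i
      fin_cases i
      · exact ((hXX 1).mul (hX 0)).C_mul _
      · exact ((hX 1).mul ((((hX 2).mul (hX 0)).C_mul b).sub hD)).C_mul _
      · exact (hX 2).mul hD
    · change MvPolynomial.eval ![0, 1, 0] _ ≠ 0
      simp [hc]
    · simp
    · simp
    · intro x y hx hxy
      refine ⟨x, ?_, ?_, ?_⟩
      · simp; ring
      · simp
        linear_combination -c ^ 3 * y * hxy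
      · simp
        linear_combination hxy
  · by_cases hx : x = 0
    · subst hx
      obtain rfl : y = 0 := by simpa using hxy
      refine ⟨4, ![.C (c ^ 2) * (.X 1 * (.X 0 ^ 2 + .C a * (.X 0 * .X 2) + .C b * .X 2 ^ 2) * .X 2),
        .C (c ^ 3) * ((.X 0 ^ 2 + .C a * (.X 0 * .X 2) + .C b * .X 2 ^ 2) *
          (.C b * .X 2 ^ 2 - .X 0 ^ 2)), .X 0 * .X 1 * .X 2 ^ 2], ?_, ⟨1, ?_⟩,
        isog_chart hA hB ?_ ?_ ?_⟩
      · have hQ : (.X 0 ^ 2 + .C a * (.X 0 * .X 2) + .C b * .X 2 ^ 2 :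
            MvPolynomial (Fin 3) ℂ).IsHomogeneous 2 :=
          ((hXX 0).add (((hX 0).mul (hX 2)).C_mul a)).add ((hXX 2).C_mul b)
        intro i
        fin_cases i
        · exact (((hX 1).mul hQ).mul (hX 2)).C_mul _
        · exact (hQ.mul (((hXX 2).C_mul b).sub (hXX 0))).C_mul _
        · exact ((hX 0).mul (hX 1)).mul (hXX 2)
      · change MvPolynomial.eval ![0, 0, 1] _ ≠ 0
        simp [hc, hb]
      · simp
      · simp
      · intro x y hx hxy
        refine ⟨y / x, ?_, ?_, ?_⟩
        · simp
          field_simp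
          linear_combination -y * hxy
        · simp
          field_simp
          linear_combination -(b - x ^ 2) * hxy
        · simp
          field_simp
    · refine ⟨3, ![.C (c ^ 2) * (.X 1 ^ 2 * .X 2),
        .C (c ^ 3) * (.X 1 * (.C b * .X 2 ^ 2 - .X 0 ^ 2)), .X 0 ^ 2 * .X 2], ?_, ⟨2, ?_⟩,
        isog_chart hA hB ?_ ?_ ?_⟩
      · intro i
        fin_cases i
        · exact ((hXX 1).mul (hX 2)).C_mul _
        · exact ((hX 1).mul (((hXX 2).C_mul b).sub (hXX 0))).C_mul _
        · exact (hXX 0).mul (hX 2)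
      · change MvPolynomial.eval ![x, y, 1] _ ≠ 0
        simpa using hx
      · simp
      · simp
      · intro x y hx hxy
        refine ⟨1, ?_, ?_, ?_⟩
        · simp
        · simp; ring
        · simp

lemma isIsogeny_isog (hc : c ≠ 0) : IsIsogeny _ _ (isog (c := c) hA hB) :=
  ⟨isMorphism_isog hA hB hc, rfl⟩

/-- The composition of the isogeny with its dual is multiplication by two. -/
lemma isog_isog (hcc : 2 * c * c' = 1) (hA' : a = -2 * A * c' ^ 2)
    (hB' : b = (A ^ 2 - 4 * B) * c' ^ 4) (P : (twoTorsionCurve a b).toAffine.Point) :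
    isog hA' hB' (isog hA hB P) = 2 • P := by
  have hc : c ≠ 0 := by rintro rfl; simp at hcc
  rcases eq_zero_or_eq_pt P with rfl | ⟨x, y, hxy, rfl⟩
  · rw [isog_zero, isog_zero]; exact (nsmul_zero 2).symm
  by_cases hy : y = 0
  · subst hy
    rw [two_smul_pt_zero]
    by_cases hx : x = 0
    · subst hx
      rw [isog_pt_zero, isog_zero]
    · rw [isog_pt _ _ _ hx, isog_eq_zero_iff]
      right
      exact pt_congr (by simp) (by simp)
  · have hx : x ≠ 0 := by
      rintro rfl
      apply hy
      simpa using hxy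
    have hc' : c' = 1 / (2 * c) := by field_simp; linear_combination hcc
    rw [isog_pt _ _ _ hx, isog_pt _ _ _ (by positivity), eq_comm]
    -- The normalization `2 c c' = 1` yields the abscissa `(x² - b)² / (4 y²)` of the duplication
    -- formula.
    have hX : c' ^ 2 * (c ^ 3 * y * (b - x ^ 2) / x ^ 2) ^ 2 / (c ^ 2 * y ^ 2 / x ^ 2) ^ 2 =
        (x ^ 2 - b) ^ 2 / (4 * y ^ 2) := by
      rw [hc']; field_simp; ring
    refine two_smul_pt hxy hy rfl ?_ ?_ _
    · rw [hX]
      field_simp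
      linear_combination (16 * a + 32 * x) * hxy
    · rw [hX, hB, hc']
      field_simp
      have h4 : y ^ 4 = (x ^ 3 + a * x ^ 2 + b * x) ^ 2 := by rw [← hxy]; ring
      rw [h4, hxy]
      ring

/-- The map on abscissas is a nonconstant rational function, hence surjective. This lifts a point up
to sign, and the sign is corrected because the isogeny is odd. -/
lemma isog_surjective (hc : c ≠ 0) : Function.Surjective (isog (c := c) hA hB) := by
  have hb := b_ne_zero (a := a) (b := b) inferInstance
  intro Q
  obtain ⟨z, hz⟩ := isogX_surjective (a := a) (c := c) hb hc (xMap _ Q)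
  obtain ⟨P, rfl⟩ := xMap_surjective (a := a) (b := b) z
  rw [← xMap_isog hA hB, xMap_eq_iff] at hz
  rcases hz with hz | hz
  · exact ⟨P, hz⟩
  · refine ⟨-P, ?_⟩
    rw [← neg_eq_iff_eq_neg] at hz
    rw [← hz]
    rcases eq_zero_or_eq_pt P with rfl | ⟨x, y, hxy, rfl⟩
    · rw [neg_zero, isog_zero, neg_zero]
    · rw [neg_pt]
      by_cases hx : x = 0
      · subst hx
        rw [isog_pt_zero, isog_pt_zero, neg_zero]
      · rw [isog_pt _ _ _ hx, isog_pt _ _ _ hx, neg_pt]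
        exact pt_congr (by ring) (by ring)

end

/-! ### Translation by the marked point -/

/-- The involution `z ↦ b / z`. -/
def involution (b : ℂ) (z : OnePoint ℂ) : OnePoint ℂ := z.elim (0 : ℂ) fun x => sphereMk b x

lemma involution_coe (b x : ℂ) : involution b (x : OnePoint ℂ) = sphereMk b x := rfl

lemma involution_infty (b : ℂ) : involution b OnePoint.infty = (0 : ℂ) := rfl

lemma isRationalMap_involution {b : ℂ} (hb : b ≠ 0) : IsRationalMap (involution b) := by
  refine isRationalMap_iff.mpr ⟨1, C b, X, by simp, by simp, ?_, by simp, ?_, ?_⟩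
  · rw [isCoprime_iff_eval_ne_zero]
    intro z
    left; simpa using hb
  · intro z
    simp [involution_coe]
  · rw [involution_infty]
    simp [sphereMk]

/-- A line `y = ℓ x` through `(0, 0)` meets the curve where `x² + (a - ℓ²) x + b = 0`, so the
product of the two other abscissas is `b`. -/
lemma xMap_add {a b : ℂ} [(twoTorsionCurve a b).IsElliptic]
    (P : (twoTorsionCurve a b).toAffine.Point) :
    xMap _ (P + pt 0 0 (by ring)) = involution b (xMap _ P) := by
  rcases eq_zero_or_eq_pt P with rfl | ⟨x, y, hxy, rfl⟩
  · rw [zero_add, xMap_zero, xMap_pt, involution_infty]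
  · rw [xMap_pt, involution_coe]
    by_cases hx : x = 0
    · subst hx
      obtain rfl : y = 0 := by simpa using hxy
      rw [← two_nsmul, two_smul_pt_zero, sphereMk_zero, xMap_zero]
    · have e : (y / x) ^ 2 = x + a + b / x := by
        rw [div_pow, hxy]; field_simp
      rw [pt_add_pt_of_ne hxy (by ring) hx (ℓ := y / x) (X := b / x) (Y := -(b * y / x ^ 2)) (by simp)
        (by rw [e]; ring) (by field_simp; ring) (by field_simp; linear_combination b ^ 2 * hxy), xMap_pt,
        sphereMk_of_ne hx]

end twoTorsionCurve

/-! ### Subgroups of order two -/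

section OrderTwo

variable {G : Type*} [AddCommGroup G]

lemma mem_zmultiples_iff_of_two_nsmul {T : G} (hT : 2 • T = 0) (P : G) :
    P ∈ AddSubgroup.zmultiples T ↔ P = 0 ∨ P = T := by
  rw [AddSubgroup.mem_zmultiples_iff]
  have h2 : (2 : ℤ) • T = 0 := by exact_mod_cast hT
  constructor
  · rintro ⟨k, rfl⟩
    rcases Int.even_or_odd' k with ⟨m, rfl | rfl⟩
    · left
      rw [mul_comm, mul_zsmul, h2, zsmul_zero]
    · right
      rw [add_zsmul, mul_comm, mul_zsmul, h2, zsmul_zero, zero_add, one_zsmul]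
  · rintro (rfl | rfl)
    · exact ⟨0, zero_zsmul _⟩
    · exact ⟨1, one_zsmul _⟩

lemma card_zmultiples_of_two_nsmul {T : G} (hT0 : T ≠ 0) (hT : 2 • T = 0) :
    Nat.card (AddSubgroup.zmultiples T) = 2 := by
  rw [Nat.card_zmultiples]
  exact addOrderOf_eq_prime hT hT0

lemma AddSubgroup.exists_of_card_eq_two {Γ : AddSubgroup G} (h : Nat.card Γ = 2) :
    ∃ T, T ≠ 0 ∧ 2 • T = 0 ∧ ∀ P, P ∈ Γ ↔ P = 0 ∨ P = T := by
  have hne : Γ ≠ ⊥ := by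
    rintro rfl
    simp at h
  obtain ⟨T, hT0⟩ := AddSubgroup.ne_bot_iff_exists_ne_zero.mp hne
  replace hT0 : (T : G) ≠ 0 := fun e => hT0 (Subtype.ext e)
  have hT : 2 • (T : G) = 0 := by
    have := card_nsmul_eq_zero' (G := Γ) (x := T)
    rw [h] at this
    exact_mod_cast congrArg Subtype.val this
  have heq : AddSubgroup.zmultiples (T : G) = Γ := by
    have : Finite Γ := Nat.finite_of_card_ne_zero (by omega)
    apply AddSubgroup.eq_of_le_of_card_ge
    · rw [AddSubgroup.zmultiples_le]; exact T.2
    · rw [card_zmultiples_of_two_nsmul hT0 hT, h]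
  exact ⟨T, hT0, hT, fun P => by rw [← mem_zmultiples_iff_of_two_nsmul hT, heq]⟩

/-- A subgroup of order two and its nonzero element determine each other. -/
lemma card_addSubgroup_card_eq_two :
    Nat.card {Γ : AddSubgroup G // Nat.card Γ = 2} = {T : G | T ≠ 0 ∧ 2 • T = 0}.ncard := by
  rw [← Nat.card_coe_set_eq]
  symm
  refine Nat.card_congr (Equiv.ofBijective
    (fun T : {T : G | T ≠ 0 ∧ 2 • T = 0} => (⟨AddSubgroup.zmultiples T.1,
      card_zmultiples_of_two_nsmul T.2.1 T.2.2⟩ : {Γ : AddSubgroup G // Nat.card Γ = 2})) ⟨?_, ?_⟩)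
  · rintro ⟨T, hT0, hT⟩ ⟨T', hT0', hT'⟩ h
    simp only [Subtype.mk.injEq] at h
    have : T ∈ AddSubgroup.zmultiples T' := h ▸ AddSubgroup.mem_zmultiples T
    rw [mem_zmultiples_iff_of_two_nsmul hT'] at this
    exact Subtype.ext (this.resolve_left hT0)
  · rintro ⟨Γ, hΓ⟩
    obtain ⟨T, hT0, hT, hmem⟩ := AddSubgroup.exists_of_card_eq_two hΓ
    refine ⟨⟨T, hT0, hT⟩, Subtype.ext (AddSubgroup.ext fun P => ?_)⟩
    rw [hmem]
    exact mem_zmultiples_iff_of_two_nsmul hT P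

end OrderTwo

/-! ### Decompositions and critical values, from the group structure alone -/

/-- The formal properties of the quotient of an elliptic curve by `±1`. -/
structure IsKummerMap {G : Type} [AddCommGroup G] (π : G → OnePoint ℂ) : Prop where
  surjective : Function.Surjective π
  eq_iff : ∀ {P Q}, π P = π Q ↔ P = Q ∨ P = -Q
  translate : ∀ T, 2 • T = 0 → ∃ τ, IsRationalMap τ ∧ ∀ P, π (P + T) = τ (π P)
  ncard_torsion : {T : G | 2 • T = 0}.ncard = 4

namespace IsKummerMap

variable {G : Type} [AddCommGroup G] {π : G → OnePoint ℂ}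

lemma neg (hπ : IsKummerMap π) (P : G) : π (-P) = π P := hπ.eq_iff.mpr (Or.inr rfl)

lemma map_eq_map_zero_iff (hπ : IsKummerMap π) {P : G} : π P = π 0 ↔ P = 0 := by
  rw [hπ.eq_iff, neg_zero, or_self]

lemma finite_torsion (hπ : IsKummerMap π) : {T : G | 2 • T = 0}.Finite :=
  Set.finite_of_ncard_ne_zero (by rw [hπ.ncard_torsion]; norm_num)

lemma exists_two_nsmul_ne_zero (hπ : IsKummerMap π) : ∃ P : G, 2 • P ≠ 0 := by
  by_contra! h
  have h1 : (Set.univ : Set G).Finite := hπ.finite_torsion.subset fun P _ => h P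
  have h2 := h1.image π
  rw [Set.image_univ, hπ.surjective.range_eq] at h2
  exact Set.infinite_univ h2

/-- The fibres of `π ∘ [2]`. -/
lemma exists_torsion (hπ : IsKummerMap π) {P Q : G} (h : π (2 • Q) = π (2 • P)) :
    ∃ T, 2 • T = 0 ∧ π Q = π (P + T) := by
  rcases hπ.eq_iff.mp h with h | h
  · exact ⟨Q - P, by rw [nsmul_sub, h, sub_self], by rw [add_sub_cancel]⟩
  · refine ⟨-Q - P, by rw [nsmul_sub, smul_neg, h, neg_neg, sub_self], ?_⟩
    rw [add_sub_cancel, hπ.neg]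

variable {L U V : OnePoint ℂ → OnePoint ℂ}

/-- A nontrivial decomposition `L = U ∘ V` has a right factor of degree two that is invariant under
the translation by a point of order two. -/
lemma exists_translation_invariant (hπ : IsKummerMap π) (hL : ∀ P, L (π P) = π (2 • P))
    (h : IsNontrivialDecomposition L U V) : ∃ T : G, T ≠ 0 ∧ 2 • T = 0 ∧
      (∀ P, V (π (P + T)) = V (π P)) ∧ ∃ p q, IsRatPair 2 p q V := by
  obtain ⟨d, p, q, hpq⟩ := isRationalMap_iff.mp h.right
  have hLUV : ∀ z, L z = U (V z) := fun z => congrFun h.eq_comp z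
  have hd : d ≠ 0 := by
    rintro rfl
    obtain ⟨P, hP⟩ := hπ.exists_two_nsmul_ne_zero
    apply hP
    rw [← hπ.map_eq_map_zero_iff, ← hL, hLUV, hpq.eq_const, ← hpq.eq_const (π 0), ← hLUV, hL,
      nsmul_zero]
  have hVs := hpq.surjective hd
  let E₂ : AddSubgroup G :=
    { carrier := {T | 2 • T = 0}
      zero_mem' := nsmul_zero 2
      add_mem' := fun {a b} (ha : 2 • a = 0) (hb : 2 • b = 0) => by
        change 2 • (a + b) = 0
        rw [nsmul_add, ha, hb, add_zero]
      neg_mem' := fun {a} (ha : 2 • a = 0) => by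
        change 2 • (-a) = 0
        rw [smul_neg, ha, neg_zero] }
  have hE₂ : Nat.card E₂ = 4 := hπ.ncard_torsion
  -- The 2-torsion translations that preserve `V ∘ π`. The order of `H` turns out to be the degree
  -- of `V` in the cases that remain.
  let H : AddSubgroup G :=
    { carrier := {T | 2 • T = 0 ∧ ∀ P, V (π (P + T)) = V (π P)}
      zero_mem' := ⟨nsmul_zero 2, fun P => by rw [add_zero]⟩
      add_mem' := fun {a b} ha hb => ⟨by rw [nsmul_add, ha.1, hb.1, add_zero], fun P => by
        rw [← add_assoc, hb.2, ha.2]⟩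
      neg_mem' := fun {a} ha => ⟨by rw [smul_neg, ha.1, neg_zero], fun P => by
        rw [← ha.2 (P + -a), neg_add_cancel_right]⟩ }
  have hH : ∀ T, T ∈ H ↔ 2 • T = 0 ∧ ∀ P, V (π (P + T)) = V (π P) := fun T => Iff.rfl
  have hle : H ≤ E₂ := fun T hT => hT.1
  have hfinE : Finite E₂ := Nat.finite_of_card_ne_zero (by omega)
  -- The points where some translation outside `H` happens to preserve the value of `V`. For each
  -- such `T` they are finitely many, since otherwise the identity principle would put `T` in `H`.
  set B : Set (OnePoint ℂ) := ⋃ T ∈ {T | 2 • T = 0 ∧ T ∉ H}, {z | ∃ P, π P = z ∧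
    V (π (P + T)) = V (π P)} with hB
  have hBfin : B.Finite := by
    refine Set.Finite.biUnion (hπ.finite_torsion.subset fun T hT => hT.1) ?_
    rintro T ⟨hT, hTH⟩
    obtain ⟨τ, hτ, hτP⟩ := hπ.translate T hT
    by_contra hinf
    apply hTH
    have hcomp : V ∘ τ = V := by
      refine (h.right.comp hτ).eq_of_infinite h.right (Set.Infinite.mono ?_ hinf)
      rintro _ ⟨P, rfl, hP⟩
      simpa [← hτP] using hP
    exact ⟨hT, fun P => by rw [hτP]; exact congrFun hcomp _⟩
  have hgen : ∀ P, π P ∉ B → ∀ Q, V (π Q) = V (π P) → ∃ T ∈ H, π Q = π (P + T) := by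
    intro P hP Q hQ
    obtain ⟨T, hT, hQT⟩ := hπ.exists_torsion (P := P) (Q := Q) (by rw [← hL, ← hL, hLUV, hLUV, hQ])
    refine ⟨T, ?_, hQT⟩
    by_contra hTH
    apply hP
    rw [hB]
    simp only [Set.mem_iUnion]
    exact ⟨T, ⟨hT, hTH⟩, P, rfl, by rw [← hQT, hQ]⟩
  have hdvd : Nat.card H ∣ 2 ^ 2 := by
    have := AddSubgroup.card_dvd_of_le hle
    rwa [hE₂] at this
  obtain ⟨k, hk, hcard⟩ := (Nat.dvd_prime_pow Nat.prime_two).mp hdvd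
  -- Order 1: general fibres of `V` are points and `V` is invertible. Order 2: the case of the
  -- statement. Order 4: `V` takes one value on each fibre of `L`, so `U` is injective.
  interval_cases k
  · exfalso
    rw [pow_zero, AddSubgroup.card_eq_one] at hcard
    apply h.right_not_invertible
    have hd1 : d = 1 := by
      refine hpq.degree_eq (hBfin.image V) fun t ht => ?_
      obtain ⟨z, rfl⟩ := hVs t
      obtain ⟨P, rfl⟩ := hπ.surjective z
      have hP : π P ∉ B := fun hP => ht ⟨_, hP, rfl⟩
      rw [Set.ncard_eq_one]
      refine ⟨π P, Set.Subset.antisymm (fun w hw => ?_) (by simp)⟩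
      obtain ⟨Q, rfl⟩ := hπ.surjective w
      obtain ⟨T, hT, hQ⟩ := hgen P hP Q hw
      rw [hcard, AddSubgroup.mem_bot] at hT
      rw [hQ, hT, add_zero]
      rfl
    subst hd1
    exact hpq.isInvertibleMap
  · rw [pow_one] at hcard
    obtain ⟨T, hT0, hT, hmem⟩ := AddSubgroup.exists_of_card_eq_two hcard
    have hTH : T ∈ H := (hmem T).mpr (Or.inr rfl)
    refine ⟨T, hT0, hT, hTH.2, p, q, ?_⟩
    obtain ⟨τ, hτ, hτP⟩ := hπ.translate T hT
    -- Off this set `π(P + T) ≠ π P`, so the fibre has two distinct points. The map `τ` is not the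
    -- identity since it sends `π 0` to `π T ≠ π 0`.
    have hfix : {z | τ z = id z}.Finite := by
      by_contra hinf
      have := hτ.eq_of_infinite isRationalMap_id hinf
      have h0 := hτP 0
      rw [this, id, zero_add, hπ.map_eq_map_zero_iff] at h0
      exact hT0 h0
    have hd2 : d = 2 := by
      refine hpq.degree_eq ((hBfin.union hfix).image V) fun t ht => ?_
      obtain ⟨z, rfl⟩ := hVs t
      obtain ⟨P, rfl⟩ := hπ.surjective z
      have hP : π P ∉ B := fun hP => ht ⟨_, Or.inl hP, rfl⟩
      have hP' : π (P + T) ≠ π P := fun e => ht ⟨π P, Or.inr (by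
        rw [Set.mem_ofPred_eq, ← hτP]; exact e), rfl⟩
      have : V ⁻¹' {V (π P)} = {π (P + T), π P} := by
        ext w
        obtain ⟨Q, rfl⟩ := hπ.surjective w
        simp only [Set.mem_preimage, Set.mem_singleton_iff, Set.mem_insert_iff]
        constructor
        · intro hw
          obtain ⟨S, hS, hQ⟩ := hgen P hP Q hw
          rcases (hmem S).mp hS with rfl | rfl
          · right; rw [hQ, add_zero]
          · left; exact hQ
        · rintro (e | e)
          · rw [e, hTH.2]
          · rw [e]
      rw [this, Set.ncard_pair hP']
    rwa [← hd2]
  · exfalso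
    have hHE : H = E₂ := AddSubgroup.eq_of_le_of_card_ge hle (by rw [hE₂, hcard]; norm_num)
    apply h.left_not_invertible
    refine h.left.isInvertibleMap_of_injective fun s s' hs => ?_
    obtain ⟨z, rfl⟩ := hVs s
    obtain ⟨z', rfl⟩ := hVs s'
    obtain ⟨P, rfl⟩ := hπ.surjective z
    obtain ⟨Q, rfl⟩ := hπ.surjective z'
    rw [← hLUV, ← hLUV, hL, hL] at hs
    obtain ⟨T, hT, hPT⟩ := hπ.exists_torsion hs
    have : T ∈ H := by rw [hHE]; exact hT
    rw [hPT, this.2]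

/-- The critical values of `L` are the images of the points of order two. -/
lemma setOf_ncard_fibre_ne (hπ : IsKummerMap π) (hL : ∀ P, L (π P) = π (2 • P))
    (h2 : ∀ Q : G, ∃ P, 2 • P = Q) :
    {t | (L ⁻¹' {t}).ncard ≠ 4} = π '' {T | T ≠ 0 ∧ 2 • T = 0} := by
  have key : ∀ Q : G, (L ⁻¹' {π Q}).ncard ≠ 4 ↔ Q ≠ 0 ∧ 2 • Q = 0 := by
    intro Q
    obtain ⟨P₀, hP₀⟩ := h2 Q
    have hset : L ⁻¹' {π Q} = π '' {P | 2 • P = Q} := by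
      ext z
      obtain ⟨P, rfl⟩ := hπ.surjective z
      simp only [Set.mem_preimage, Set.mem_singleton_iff, hL, Set.mem_image, Set.mem_ofPred_eq]
      constructor
      · intro h
        rcases hπ.eq_iff.mp h with h | h
        · exact ⟨P, h, rfl⟩
        · exact ⟨-P, by rw [smul_neg, h, neg_neg], hπ.neg P⟩
      · rintro ⟨P', h, h'⟩
        rcases hπ.eq_iff.mp h' with rfl | rfl
        · rw [h]
        · rw [← h, smul_neg, hπ.neg]
    have hA : {P | 2 • P = Q} = (fun T => P₀ + T) '' {T | 2 • T = 0} := by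
      ext P
      simp only [Set.mem_ofPred_eq, Set.mem_image]
      constructor
      · intro h
        exact ⟨P - P₀, by rw [nsmul_sub, h, hP₀, sub_self], by rw [add_sub_cancel]⟩
      · rintro ⟨T, hT, rfl⟩
        rw [nsmul_add, hT, hP₀, add_zero]
    have hfin : {P | 2 • P = Q}.Finite := by
      rw [hA]; exact hπ.finite_torsion.image _
    have hcard : {P | 2 • P = Q}.ncard = 4 := by
      rw [hA, Set.ncard_image_of_injective _ (add_right_injective P₀), hπ.ncard_torsion]
    -- The point `Q` has four halves, and `π` identifies two of them only if they are opposite, so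
    -- that `Q = -Q`. Conversely, if `Q = -Q ≠ 0`, then `P₀` and `-P₀` are distinct halves. For `Q =
    -- 0` every half is its own opposite, so nothing is identified.
    rw [hset, ← hcard, Ne, Set.ncard_image_iff hfin]
    constructor
    · intro h
      unfold Set.InjOn at h
      push Not at h
      obtain ⟨P, hP, P', hP', he, hne⟩ := h
      have hP : 2 • P = Q := hP
      have hP' : 2 • P' = Q := hP'
      have e := (hπ.eq_iff.mp he).resolve_left hne
      have hQ : Q = -Q := by
        conv_lhs => rw [← hP, e, smul_neg, hP']
      refine ⟨?_, ?_⟩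
      · rintro rfl
        apply hne
        rw [e, neg_eq_iff_add_eq_zero, ← two_nsmul, hP']
      · rw [two_nsmul]
        nth_rewrite 1 [hQ]
        exact neg_add_cancel Q
    · rintro ⟨hQ0, hQ2⟩ hinj
      have hneg : Q = -Q := by rwa [eq_neg_iff_add_eq_zero, ← two_nsmul]
      have := hinj (show 2 • P₀ = Q from hP₀) (show 2 • (-P₀) = Q by rw [smul_neg, hP₀, ← hneg])
        (hπ.neg P₀).symm
      apply hQ0
      rw [← hP₀, two_nsmul]
      nth_rewrite 1 [this]
      exact neg_add_cancel P₀
  ext t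
  obtain ⟨Q, rfl⟩ := hπ.surjective t
  rw [Set.mem_ofPred_eq, key]
  constructor
  · exact fun h => ⟨Q, h, rfl⟩
  · rintro ⟨Q', h, h'⟩
    rcases hπ.eq_iff.mp h' with rfl | rfl
    · exact h
    · have h : -Q ≠ 0 ∧ 2 • (-Q) = 0 := h
      rwa [smul_neg, neg_eq_zero, neg_ne_zero] at h

end IsKummerMap

/-! ### Functions of degree two invariant under `z ↦ b / z` -/

namespace twoTorsionCurve

/-- A rational function of degree two that is invariant under `z ↦ b / z` is a Möbius
transformation of `z + a + b / z`. -/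
lemma exists_mobius_comp_isogX {a b : ℂ} (hb : b ≠ 0) {p q : ℂ[X]} {f : OnePoint ℂ → OnePoint ℂ}
    (h : IsRatPair 2 p q f) (hf : ∀ z, f (involution b z) = f z) :
    ∃ ν : OnePoint ℂ ≃ OnePoint ℂ, IsMobius ν ∧ f = ν ∘ isogX a b 1 := by
  have hev : ∀ r : ℂ[X], r.natDegree ≤ 2 → ∀ z,
      r.eval z = r.coeff 2 * z ^ 2 + r.coeff 1 * z + r.coeff 0 := by
    intro r hr z
    rw [eval_eq_sum_range' (Nat.lt_succ_of_le hr)]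
    simp [Finset.sum_range_succ]
    ring
  have hp := hev p h.natDegree_left
  have hq := hev q h.natDegree_right
  have hne := h.eval_ne
  have hcoe := h.map_coe
  have hinf := h.map_infty
  have hlead := h.coeff_ne
  simp only [hp, hq] at hcoe hne
  generalize p.coeff 2 = p₂ at *
  generalize p.coeff 1 = p₁ at *
  generalize p.coeff 0 = p₀ at *
  generalize q.coeff 2 = q₂ at *
  generalize q.coeff 1 = q₁ at *
  generalize q.coeff 0 = q₀ at *
  -- The involution exchanges `∞` and `0`; equality of the values there makes the constant
  -- coefficients proportional to the leading ones.
  obtain ⟨k, rfl, rfl⟩ : ∃ k, p₀ = k * p₂ ∧ q₀ = k * q₂ := by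
    have h0 := hf OnePoint.infty
    have h1 := hne 0
    rw [involution_infty, hcoe, hinf, sphereMk_eq_iff h1 hlead] at h0
    simp only [ne_eq, OfNat.ofNat_ne_zero, not_false_eq_true, zero_pow, mul_zero, zero_add] at h0
    rcases hlead with hl | hl
    · exact ⟨p₀ / p₂, by field_simp, by field_simp; linear_combination -h0⟩
    · exact ⟨q₀ / q₂, by field_simp; linear_combination h0, by field_simp⟩
  -- Otherwise `p` and `q` are multiples of one quadratic polynomial, whose root is a common zero.
  have hD : p₂ * q₁ - p₁ * q₂ ≠ 0 := by
    intro hD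
    obtain ⟨l, rfl, rfl⟩ : ∃ l, p₁ = l * p₂ ∧ q₁ = l * q₂ := by
      rcases hlead with hl | hl
      · exact ⟨p₁ / p₂, by field_simp, by field_simp; linear_combination hD⟩
      · exact ⟨q₁ / q₂, by field_simp; linear_combination -hD, by field_simp⟩
    obtain ⟨z, hz⟩ := IsAlgClosed.exists_root (X ^ 2 + C l * X + C k : ℂ[X]) (by
      have : (X ^ 2 + C l * X + C k : ℂ[X]).degree = 2 := by compute_degree!
      rw [this]; norm_num)
    have hz' : z ^ 2 + l * z + k = 0 := by simpa [IsRoot] using hz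
    rcases hne z with h1 | h1
    · apply h1; linear_combination p₂ * hz'
    · apply h1; linear_combination q₂ * hz'
  obtain rfl : k = b := by
    -- Invariance at `z` reads `(p₂ q₁ - p₁ q₂) z (b - k) (z² - b) = 0`. A point with `z ≠ 0` and
    -- `z² ≠ b` is needed; `z² = 4 b` provides one.
    obtain ⟨z, hz⟩ := IsAlgClosed.exists_pow_nat_eq (4 * b) (n := 2) (by norm_num)
    have hz0 : z ≠ 0 := by
      rintro rfl
      simp [hb] at hz
    have h0 := hf z
    rw [involution_coe, sphereMk_of_ne hz0, hcoe, hcoe, sphereMk_eq_iff (hne _) (hne _)] at h0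
    field_simp at h0
    have h1 : (p₂ * q₁ - p₁ * q₂) * (z * (b - k) * (z ^ 2 - b)) = 0 := by
      linear_combination -h0
    have h2 : z * (b - k) * (z ^ 2 - b) = 0 := (mul_eq_zero.mp h1).resolve_left hD
    have h3 : z ^ 2 - b ≠ 0 := by
      rw [hz]
      intro e
      apply hb
      linear_combination e / 3
    have h4 := (mul_eq_zero.mp ((mul_eq_zero.mp h2).resolve_right h3)).resolve_left hz0
    linear_combination -h4
  -- The matrix comes from `p₂ z² + p₁ z + b p₂ = z (p₂ (z + a + b / z) + p₁ - a p₂)`, and likewise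
  -- for `q`.
  have hdet : (Matrix.of ![![p₂, p₁ - a * p₂], ![q₂, q₁ - a * q₂]]).det ≠ 0 := by
    rw [Matrix.det_fin_two]
    simp only [Matrix.of_apply, Matrix.cons_val_zero, Matrix.cons_val_one]
    intro e
    apply hD
    linear_combination e
  refine ⟨_, isMobius_toPerm (Matrix.GeneralLinearGroup.mkOfDetNeZero _ hdet), ?_⟩
  set g := Matrix.GeneralLinearGroup.mkOfDetNeZero _ hdet with hg
  have hgi : g • (OnePoint.infty : OnePoint ℂ) = sphereMk p₂ q₂ := by
    rw [OnePoint.smul_infty_eq_ite]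
    rfl
  have hgc : ∀ s : ℂ, g • (s : OnePoint ℂ) = sphereMk (p₂ * s + (p₁ - a * p₂)) (q₂ * s + (q₁ - a * q₂)) := by
    intro s
    rw [OnePoint.smul_some_eq_ite]
    rfl
  funext z
  simp only [Function.comp, MulAction.toPerm_apply]
  induction z using OnePoint.rec with
  | infty => rw [isogX_infty, hgi, hinf]
  | coe z =>
    rw [isogX_coe, hcoe]
    by_cases hz : z = 0
    · subst hz
      rw [sphereMk_zero, hgi]
      simp only [ne_eq, OfNat.ofNat_ne_zero, not_false_eq_true, zero_pow, mul_zero, zero_add]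
      rw [sphereMk_mul hb]
    · rw [sphereMk_of_ne hz, hgc, eq_comm, ← sphereMk_mul hz]
      congr 1 <;> field_simp <;> ring

end twoTorsionCurve

/-! ### Quotient curve, factorization of the modular polynomial, points of order two -/

namespace twoTorsionCurve

lemma dual_isElliptic {a b : ℂ} (h : (twoTorsionCurve a b).IsElliptic) :
    (twoTorsionCurve (-2 * a) (a ^ 2 - 4 * b)).IsElliptic := by
  rw [isElliptic_iff] at h ⊢
  refine ⟨h.2, ?_⟩
  have : (-2 * a) ^ 2 - 4 * (a ^ 2 - 4 * b) = 16 * b := by ring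
  rw [this]
  exact mul_ne_zero (by norm_num) h.1

/-- The `j`-invariant of the quotient of `y² = x³ + a x² + b x` by `(0, 0)`. -/
def dualJ (a b : ℂ) : ℂ := 16 * (a ^ 2 + 12 * b) ^ 3 / (b * (a ^ 2 - 4 * b) ^ 2)

lemma j_dual {a b : ℂ} (h : (twoTorsionCurve a b).IsElliptic)
    (h' : (twoTorsionCurve (-2 * a) (a ^ 2 - 4 * b)).IsElliptic) :
    (twoTorsionCurve (-2 * a) (a ^ 2 - 4 * b)).j = dualJ a b := by
  have h1 := b_ne_zero h
  have h2 := disc_ne_zero h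
  have h3 : (-2 * a) ^ 2 - 4 * (a ^ 2 - 4 * b) = 16 * b := by ring
  rw [j_eq h', dualJ, h3]
  field_simp
  ring

lemma exists_roots {a b : ℂ} (h : (twoTorsionCurve a b).IsElliptic) :
    ∃ r s : ℂ, a = -(r + s) ∧ b = r * s ∧ r ≠ 0 ∧ s ≠ 0 ∧ r ≠ s := by
  obtain ⟨r, hr⟩ := IsAlgClosed.exists_root (X ^ 2 + C a * X + C b : ℂ[X]) (by
      have : (X ^ 2 + C a * X + C b : ℂ[X]).degree = 2 := by compute_degree!
      rw [this]; norm_num)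
  have hr' : r ^ 2 + a * r + b = 0 := by simpa [IsRoot] using hr
  have hb : b = r * (-a - r) := by linear_combination hr'
  have h1 := b_ne_zero h
  have h2 := disc_ne_zero h
  refine ⟨r, -a - r, by ring, hb, ?_, ?_, ?_⟩
  · rintro rfl
    simp [hb] at h1
  · intro e
    rw [e] at hb
    simp [hb] at h1
  · intro e
    apply h2
    rw [hb]
    linear_combination (a + 2 * r) * e

/-- The modular equation of level two. -/
lemma modularPhiTwo_eq {r s : ℂ} (h : (twoTorsionCurve (-(r + s)) (r * s)).IsElliptic)
    (hr : r ≠ 0) (hs : s ≠ 0) (hrs : r ≠ s) (Y : ℂ) :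
    modularPhiTwo (twoTorsionCurve (-(r + s)) (r * s)).j Y =
      (Y - dualJ (-(r + s)) (r * s)) * (Y - dualJ (2 * r - s) (r * (r - s))) *
        (Y - dualJ (2 * s - r) (s * (s - r))) := by
  -- Moving `(r, 0)` to the origin turns `x (x - r) (x - s)` into `x³ + (2 r - s) x² + r (r - s) x`,
  -- and symmetrically for `s`. The three factors thus belong to the quotients by the three points
  -- of order two.
  have hd : r - s ≠ 0 := sub_ne_zero.mpr hrs
  have e0 : (-(r + s)) ^ 2 - 4 * (r * s) = (r - s) ^ 2 := by ring
  have e1 : (2 * r - s) ^ 2 - 4 * (r * (r - s)) = s ^ 2 := by ring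
  have e2 : (2 * s - r) ^ 2 - 4 * (s * (s - r)) = r ^ 2 := by ring
  have e3 : s * (s - r) = -(s * (r - s)) := by ring
  rw [j_eq h, dualJ, dualJ, dualJ, e0, e1, e2, e3, modularPhiTwo]
  field_simp
  ring

lemma torsion_eq {r s : ℂ} [(twoTorsionCurve (-(r + s)) (r * s)).IsElliptic] :
    {T : (twoTorsionCurve (-(r + s)) (r * s)).toAffine.Point | 2 • T = 0} =
      {0, pt 0 0 (by ring), pt r 0 (by ring), pt s 0 (by ring)} := by
  ext T
  simp only [Set.mem_ofPred_eq, Set.mem_insert_iff, Set.mem_singleton_iff]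
  rcases eq_zero_or_eq_pt T with rfl | ⟨x, y, hxy, rfl⟩
  · simp
  · rw [two_smul_pt_eq_zero_iff]
    simp only [pt_ne_zero, false_or, pt_inj]
    constructor
    · rintro rfl
      have : x * ((x - r) * (x - s)) = 0 := by linear_combination -hxy
      simpa [sub_eq_zero] using this
    · rintro (h | h | h) <;> exact h.2

lemma ncard_torsion (a b : ℂ) [h : (twoTorsionCurve a b).IsElliptic] :
    {T : (twoTorsionCurve a b).toAffine.Point | 2 • T = 0}.ncard = 4 := by
  obtain ⟨r, s, rfl, rfl, hr, hs, hrs⟩ := exists_roots h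
  rw [torsion_eq, Set.ncard_insert_of_notMem, Set.ncard_insert_of_notMem, Set.ncard_pair]
  · simpa [pt_inj] using hrs
  · simp [pt_inj, hr.symm, hs.symm]
  · simp [(pt_ne_zero _).symm]

lemma image_xMap_torsion {r s : ℂ} [(twoTorsionCurve (-(r + s)) (r * s)).IsElliptic] :
    xMap _ '' {T : (twoTorsionCurve (-(r + s)) (r * s)).toAffine.Point | T ≠ 0 ∧ 2 • T = 0} =
      {((0 : ℂ) : OnePoint ℂ), (r : OnePoint ℂ), (s : OnePoint ℂ)} := by
  have : {T : (twoTorsionCurve (-(r + s)) (r * s)).toAffine.Point | T ≠ 0 ∧ 2 • T = 0} =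
      {pt 0 0 (by ring), pt r 0 (by ring), pt s 0 (by ring)} := by
    ext T
    have := Set.ext_iff.mp (torsion_eq (r := r) (s := s)) T
    simp only [Set.mem_ofPred_eq, Set.mem_insert_iff, Set.mem_singleton_iff] at this ⊢
    rw [this]
    constructor
    · tauto
    · rintro (rfl | rfl | rfl) <;> simp [pt_ne_zero]
  rw [this, Set.image_insert_eq, Set.image_pair]
  rfl

section

variable {a b : ℂ} [(twoTorsionCurve a b).IsElliptic]
  [(twoTorsionCurve (-2 * a) (a ^ 2 - 4 * b)).IsElliptic]

variable (a b) in
/-- The quotient by `(0, 0)`. -/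
def quotientIsog : (twoTorsionCurve a b).toAffine.Point →
    (twoTorsionCurve (-2 * a) (a ^ 2 - 4 * b)).toAffine.Point :=
  isog (c := 1) (by ring) (by ring)

variable (a b) in
/-- The dual of the quotient by `(0, 0)`. -/
def dualIsog : (twoTorsionCurve (-2 * a) (a ^ 2 - 4 * b)).toAffine.Point →
    (twoTorsionCurve a b).toAffine.Point :=
  isog (c := 1 / 2) (by ring) (by ring)

lemma isIsogeny_quotientIsog : IsIsogeny _ _ (quotientIsog a b) :=
  isIsogeny_isog _ _ one_ne_zero

lemma isIsogeny_dualIsog : IsIsogeny _ _ (dualIsog a b) :=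
  isIsogeny_isog _ _ (by norm_num)

lemma quotientIsog_eq_zero_iff {P : (twoTorsionCurve a b).toAffine.Point} :
    quotientIsog a b P = 0 ↔ P = 0 ∨ P = pt 0 0 (by ring) :=
  isog_eq_zero_iff _ _

lemma dualIsog_quotientIsog (P : (twoTorsionCurve a b).toAffine.Point) :
    dualIsog a b (quotientIsog a b P) = 2 • P :=
  isog_isog _ _ (by norm_num) _ _ P

lemma quotientIsog_dualIsog (P : (twoTorsionCurve (-2 * a) (a ^ 2 - 4 * b)).toAffine.Point) :
    quotientIsog a b (dualIsog a b P) = 2 • P :=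
  isog_isog _ _ (by norm_num) _ _ P

lemma xMap_quotientIsog (P : (twoTorsionCurve a b).toAffine.Point) :
    xMap _ (quotientIsog a b P) = isogX a b 1 (xMap _ P) := xMap_isog _ _ P

lemma xMap_dualIsog (P : (twoTorsionCurve (-2 * a) (a ^ 2 - 4 * b)).toAffine.Point) :
    xMap _ (dualIsog a b P) = isogX (-2 * a) (a ^ 2 - 4 * b) (1 / 2) (xMap _ P) := xMap_isog _ _ P

end

/-- Multiplication by two is the composition of two surjective isogenies. -/
lemma exists_two_nsmul_eq (a b : ℂ) [h : (twoTorsionCurve a b).IsElliptic]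
    (Q : (twoTorsionCurve a b).toAffine.Point) : ∃ P, 2 • P = Q := by
  have := dual_isElliptic h
  obtain ⟨R, rfl⟩ := isog_surjective (a := -2 * a) (b := a ^ 2 - 4 * b) (A := a) (B := b) (c := 1 / 2)
    (by ring) (by ring) (by norm_num) Q
  obtain ⟨P, rfl⟩ := isog_surjective (a := a) (b := b) (A := -2 * a) (B := a ^ 2 - 4 * b) (c := 1)
    (by ring) (by ring) one_ne_zero R
  exact ⟨P, (dualIsog_quotientIsog P).symm⟩

end twoTorsionCurve

open twoTorsionCurve

/-! ### Reduction of a general elliptic curve to the model with a marked point of order two -/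

section Curves

variable {W : WeierstrassCurve ℂ}

lemma isEvenDoubleCover_comp {π : W.toAffine.Point → OnePoint ℂ} (hπ : IsEvenDoubleCover W π)
    {μ : OnePoint ℂ ≃ OnePoint ℂ} (hμ : IsMobius μ) : IsEvenDoubleCover W (μ ∘ π) := by
  refine ⟨hμ.1.comp_isMorphism hπ.morphism, (hπ.degree_two.image μ).subset fun t ht => ?_,
    fun P => congrArg μ (hπ.even P)⟩
  refine ⟨μ.symm t, ?_, μ.apply_symm_apply t⟩
  have : (μ ∘ π) ⁻¹' {t} = π ⁻¹' {μ.symm t} := by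
    ext P
    simp [Equiv.eq_symm_apply]
  simpa [this] using ht

lemma IsEvenDoubleCover.comp_curveIso {W' : WeierstrassCurve ℂ} {π : W.toAffine.Point → OnePoint ℂ}
    (hπ : IsEvenDoubleCover W π) (φ : CurveIso W' W) :
    IsEvenDoubleCover W' (π ∘ φ.toAddEquiv) := by
  refine ⟨hπ.morphism.comp φ.morphism (curveCoord_ne_zero _), ?_, fun P => ?_⟩
  · convert hπ.degree_two using 4 with t
    rw [Set.preimage_comp]
    exact Set.ncard_preimage_of_injective_subset_range φ.toAddEquiv.injective
      (by rw [φ.toAddEquiv.surjective.range_eq]; exact Set.subset_univ _)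
  · simp [hπ.even]

lemma IsEvenDoubleCover.exists_mobius {π : W.toAffine.Point → OnePoint ℂ}
    (hπ : IsEvenDoubleCover W π) {a b : ℂ} [(twoTorsionCurve a b).IsElliptic]
    (φ : CurveIso W (twoTorsionCurve a b)) :
    ∃ μ : OnePoint ℂ ≃ OnePoint ℂ, IsMobius μ ∧ ∀ P, π P = μ (xMap _ (φ.toAddEquiv P)) := by
  obtain ⟨μ, hμ, h⟩ := exists_mobius_of_cover (hπ.comp_curveIso φ.symm)
  refine ⟨μ, hμ, fun P => ?_⟩
  have := congrFun h (φ.toAddEquiv P)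
  simpa [CurveIso.symm] using this

variable [W.IsElliptic]

/-- An affine point is its own opposite when `2 y = -(a₁ x + a₃)`. Substituting this into the
equation leaves the cubic `4 x³ + b₂ x² + 2 b₄ x + b₆`. -/
lemma exists_order_two (W : WeierstrassCurve ℂ) [W.IsElliptic] :
    ∃ T : W.toAffine.Point, T ≠ 0 ∧ 2 • T = 0 := by
  obtain ⟨e, he⟩ := IsAlgClosed.exists_root
    (C 4 * X ^ 3 + C W.b₂ * X ^ 2 + C (2 * W.b₄) * X + C W.b₆ : ℂ[X]) (by
      have : (C 4 * X ^ 3 + C W.b₂ * X ^ 2 + C (2 * W.b₄) * X + C W.b₆ : ℂ[X]).degree = 3 := by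
        compute_degree!
      rw [this]; norm_num)
  have he' : 4 * e ^ 3 + W.b₂ * e ^ 2 + 2 * W.b₄ * e + W.b₆ = 0 := by simpa [IsRoot] using he
  simp only [WeierstrassCurve.b₂, WeierstrassCurve.b₄, WeierstrassCurve.b₆] at he'
  have heq : W.toAffine.Equation e (-(W.a₁ * e + W.a₃) / 2) := by
    rw [Affine.equation_iff]
    linear_combination -he' / 4
  refine ⟨.some _ _ (Affine.equation_iff_nonsingular.mp heq), Affine.Point.some_ne_zero _, ?_⟩
  rw [two_nsmul]
  apply Affine.Point.add_self_of_Y_eq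
  simp only [Affine.negY]
  ring

/-- Translate `T` to the origin and take `s = -a₁ / 2` to remove `a₁`. Then `a₃` vanishes because `T
= -T`, and `a₆` vanishes because `T` lies on the curve. -/
lemma exists_curveIso {T : W.toAffine.Point} (hT0 : T ≠ 0) (hT : 2 • T = 0) :
    ∃ (a b : ℂ) (_ : (twoTorsionCurve a b).IsElliptic) (φ : CurveIso W (twoTorsionCurve a b)),
      φ.toAddEquiv T = pt 0 0 (by ring) ∧ (twoTorsionCurve a b).j = W.j := by
  rcases T with _ | ⟨x, y, hxy⟩
  · exact absurd rfl hT0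
  have hy : y = W.toAffine.negY x y := by
    by_contra hne
    rw [two_nsmul, Affine.Point.add_self_of_Y_ne hne] at hT
    exact Affine.Point.some_ne_zero _ hT
  simp only [Affine.negY] at hy
  have heq := (Affine.equation_iff _ _).mp hxy.1
  have hs : IsShift W (twoTorsionCurve
      (W.a₂ - (-W.a₁ / 2) * W.a₁ + 3 * x - (-W.a₁ / 2) ^ 2)
      (W.a₄ - (-W.a₁ / 2) * W.a₃ + 2 * x * W.a₂ - (y + x * (-W.a₁ / 2)) * W.a₁ + 3 * x ^ 2 -
        2 * (-W.a₁ / 2) * y)) x (-W.a₁ / 2) y := by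
    constructor
    · simp only; ring
    · simp only
    · simp only; linear_combination -hy
    · simp only
    · simp only; linear_combination heq
  have hE := hs.isElliptic
  refine ⟨_, _, hE, hs.curveIso, ?_, hs.j_eq⟩
  change Affine.Point.some _ _ _ = Affine.Point.some _ _ _
  rw [Affine.Point.some.injEq]
  constructor <;> ring

/-- Up to a Möbius transformation `π` is the `x`-coordinate of a model. For the translation by `T`
the model is chosen anew, with `T` at `(0, 0)`, so that the translation becomes `z ↦ b / z`. -/
lemma IsEvenDoubleCover.isKummerMap {π : W.toAffine.Point → OnePoint ℂ}
    (hπ : IsEvenDoubleCover W π) : IsKummerMap π := by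
  obtain ⟨T₀, hT₀0, hT₀⟩ := exists_order_two W
  obtain ⟨a, b, hE, φ, -, -⟩ := exists_curveIso hT₀0 hT₀
  obtain ⟨μ, hμ, hμπ⟩ := hπ.exists_mobius φ
  refine ⟨?_, ?_, ?_, ?_⟩
  · intro z
    obtain ⟨Q, hQ⟩ := xMap_surjective (a := a) (b := b) (μ.symm z)
    refine ⟨φ.toAddEquiv.symm Q, ?_⟩
    rw [hμπ, AddEquiv.apply_symm_apply, hQ, Equiv.apply_symm_apply]
  · intro P Q
    rw [hμπ, hμπ, μ.injective.eq_iff, xMap_eq_iff, ← map_neg, φ.toAddEquiv.injective.eq_iff,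
      φ.toAddEquiv.injective.eq_iff]
  · intro T hT
    by_cases hT0 : T = 0
    · subst hT0
      exact ⟨id, isRationalMap_id, fun P => by rw [add_zero, id]⟩
    · obtain ⟨a, b, hE, φ, hφ, -⟩ := exists_curveIso hT0 hT
      obtain ⟨μ, hμ, hμπ⟩ := hπ.exists_mobius φ
      refine ⟨μ ∘ involution b ∘ μ.symm,
        hμ.1.comp ((isRationalMap_involution (b_ne_zero hE)).comp hμ.2), fun P => ?_⟩
      simp only [Function.comp]
      rw [hμπ, hμπ, map_add, hφ, xMap_add, Equiv.symm_apply_apply]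
  · rw [← ncard_torsion a b, ← Set.ncard_image_of_injective _ φ.toAddEquiv.injective]
    congr 1
    ext Q
    simp only [Set.mem_image, Set.mem_ofPred_eq]
    constructor
    · rintro ⟨P, hP, rfl⟩
      rw [← map_nsmul, hP, map_zero]
    · intro hQ
      refine ⟨φ.toAddEquiv.symm Q, ?_, φ.toAddEquiv.apply_symm_apply Q⟩
      rw [← map_nsmul, hQ, map_zero]

end Curves

/-! ### Decompositions attached to 2-isogenies, and their classification -/

section Pairs

variable {W W' : WeierstrassCurve ℂ} {π : W.toAffine.Point → OnePoint ℂ}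
  {π' : W'.toAffine.Point → OnePoint ℂ} {Γ : AddSubgroup W.toAffine.Point}
  {L U V : OnePoint ℂ → OnePoint ℂ}

lemma IsTwoIsogenyPair.isLattesDoubling (h : IsTwoIsogenyPair W W' π π' Γ U V)
    (hπ' : IsEvenDoubleCover W' π') (hU : IsRationalMap U) (hV : IsRationalMap V) :
    IsLattesDoubling W' π' (V ∘ U) := by
  obtain ⟨-, ψ, ψ', -, -, -, -, hψψ', hV', hU'⟩ := h
  refine ⟨hV.comp hU, hπ', fun P => ?_⟩
  rw [Function.comp, hU', hV', hψψ']

lemma IsTwoIsogenyPair.eq_comp (h : IsTwoIsogenyPair W W' π π' Γ U V) (hπ : IsKummerMap π)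
    (hL : ∀ P, L (π P) = π (2 • P)) : L = U ∘ V := by
  obtain ⟨-, ψ, ψ', -, -, -, hψ'ψ, -, hV', hU'⟩ := h
  funext z
  obtain ⟨P, rfl⟩ := hπ.surjective z
  rw [Function.comp, hL, hV', hU', hψ'ψ]

/-- Recovers `Γ` from `V` and `π`, in a form unchanged when `V` is composed with a Möbius
transformation on the left. -/
lemma IsTwoIsogenyPair.map_eq_map_zero_iff (h : IsTwoIsogenyPair W W' π π' Γ U V)
    (hπ' : IsKummerMap π') (P : W.toAffine.Point) : V (π P) = V (π 0) ↔ P ∈ Γ := by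
  obtain ⟨-, ψ, ψ', hψ, -, hker, -, -, hV', -⟩ := h
  rw [hV', hV', hψ.map_zero, hπ'.map_eq_map_zero_iff, hker]

/-- Neither factor is injective: `V` identifies `π 0` with `π T` for the generator `T` of `Γ`, and
`U` identifies `π' 0` with `π' (ψ S)` for a 2-torsion point `S` outside `Γ`, which exists because
there are four 2-torsion points. -/
lemma IsTwoIsogenyPair.isNontrivialDecomposition (h : IsTwoIsogenyPair W W' π π' Γ U V)
    (hπ : IsKummerMap π) (hπ' : IsKummerMap π') (hd : IsDecomposition L U V) :
    IsNontrivialDecomposition L U V := by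
  refine ⟨hd, fun hU => ?_, fun hV => ?_⟩
  · obtain ⟨hΓ, ψ, ψ', hψ, hψ', hker, hψ'ψ, -, -, hU'⟩ := h
    obtain ⟨S, hS, hSΓ⟩ : ∃ S : W.toAffine.Point, 2 • S = 0 ∧ S ∉ Γ := by
      by_contra! hcon
      have hfin : (Γ : Set W.toAffine.Point).Finite :=
        Set.finite_of_ncard_ne_zero (by rw [← Nat.card_coe_set_eq]; exact hΓ ▸ two_ne_zero)
      have := Set.ncard_le_ncard (s := {T | 2 • T = 0}) (fun S hS => hcon S hS) hfin
      rw [hπ.ncard_torsion, ← Nat.card_coe_set_eq] at this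
      have h2 : Nat.card (Γ : Set W.toAffine.Point) = 2 := hΓ
      omega
    apply hSΓ
    rw [← hker, ← hπ'.map_eq_map_zero_iff]
    apply hU.injective
    rw [hU', hU', hψ'ψ, hS, hψ'.map_zero]
  · obtain ⟨T, hT0, hT, hmem⟩ := AddSubgroup.exists_of_card_eq_two h.1
    apply hT0
    rw [← hπ.map_eq_map_zero_iff]
    exact hV.injective ((h.map_eq_map_zero_iff hπ' T).mpr ((hmem T).mpr (Or.inr rfl)))

/-- The free parameter `ν` is the choice of the projection of the quotient curve; it accounts for
the whole equivalence class of a decomposition. -/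
lemma isTwoIsogenyPair_of_curveIso {a b : ℂ} [(twoTorsionCurve a b).IsElliptic]
    [(twoTorsionCurve (-2 * a) (a ^ 2 - 4 * b)).IsElliptic]
    (φ : CurveIso W (twoTorsionCurve a b)) {μ : OnePoint ℂ ≃ OnePoint ℂ} (ν : OnePoint ℂ ≃ OnePoint ℂ)
    (hπ : ∀ P, π P = μ (xMap _ (φ.toAddEquiv P))) (hΓ : Nat.card Γ = 2)
    (hmem : ∀ P, P ∈ Γ ↔ P = 0 ∨ φ.toAddEquiv P = pt 0 0 (by ring)) :
    IsTwoIsogenyPair W (twoTorsionCurve (-2 * a) (a ^ 2 - 4 * b)) π (ν ∘ xMap _) Γ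
      (μ ∘ isogX (-2 * a) (a ^ 2 - 4 * b) (1 / 2) ∘ ν.symm) (ν ∘ isogX a b 1 ∘ μ.symm) := by
  refine ⟨hΓ, quotientIsog a b ∘ φ.toAddEquiv, φ.toAddEquiv.symm ∘ dualIsog a b, ⟨?_, ?_⟩, ⟨?_, ?_⟩,
    ?_, ?_, ?_, ?_, ?_⟩
  · exact isIsogeny_quotientIsog.morphism.comp φ.morphism (curveCoord_ne_zero _)
  · simp [isIsogeny_quotientIsog.map_zero]
  · exact φ.morphism_symm.comp isIsogeny_dualIsog.morphism (curveCoord_ne_zero _)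
  · simp [isIsogeny_dualIsog.map_zero]
  · intro P
    rw [Function.comp, quotientIsog_eq_zero_iff, hmem, map_eq_zero_iff _ φ.toAddEquiv.injective]
  · intro P
    simp only [Function.comp]
    rw [dualIsog_quotientIsog, map_nsmul, AddEquiv.symm_apply_apply]
  · intro P
    simp only [Function.comp]
    rw [AddEquiv.apply_symm_apply, quotientIsog_dualIsog]
  · intro P
    simp only [Function.comp]
    rw [hπ, Equiv.symm_apply_apply, xMap_quotientIsog]
  · intro P
    simp only [Function.comp]
    rw [hπ, Equiv.symm_apply_apply, AddEquiv.apply_symm_apply, xMap_dualIsog]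

lemma isRationalMap_right {a b : ℂ} (h : (twoTorsionCurve a b).IsElliptic)
    {μ ν : OnePoint ℂ ≃ OnePoint ℂ} (hμ : IsMobius μ) (hν : IsMobius ν) :
    IsRationalMap (ν ∘ isogX a b 1 ∘ μ.symm) :=
  hν.1.comp ((isRationalMap_isogX (b_ne_zero h) one_ne_zero).comp hμ.2)

lemma isRationalMap_left {a b : ℂ} (h : (twoTorsionCurve a b).IsElliptic)
    {μ ν : OnePoint ℂ ≃ OnePoint ℂ} (hμ : IsMobius μ) (hν : IsMobius ν) :
    IsRationalMap (μ ∘ isogX (-2 * a) (a ^ 2 - 4 * b) (1 / 2) ∘ ν.symm) :=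
  hμ.1.comp ((isRationalMap_isogX (disc_ne_zero h) (by norm_num)).comp hν.2)

variable [W.IsElliptic]

/-- Classification of the nontrivial decompositions of a Lattès map. -/
lemma IsLattesDoubling.exists_eq_isogX (hL : IsLattesDoubling W π L)
    (h : IsNontrivialDecomposition L U V) :
    ∃ T : W.toAffine.Point, T ≠ 0 ∧ 2 • T = 0 ∧ V (π T) = V (π 0) ∧
      ∀ (a b : ℂ) [(twoTorsionCurve a b).IsElliptic] (φ : CurveIso W (twoTorsionCurve a b))
        (μ : OnePoint ℂ ≃ OnePoint ℂ), φ.toAddEquiv T = pt 0 0 (by ring) → IsMobius μ →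
        (∀ P, π P = μ (xMap _ (φ.toAddEquiv P))) →
        ∃ ν : OnePoint ℂ ≃ OnePoint ℂ, IsMobius ν ∧ V = ν ∘ isogX a b 1 ∘ μ.symm ∧
          U = μ ∘ isogX (-2 * a) (a ^ 2 - 4 * b) (1 / 2) ∘ ν.symm := by
  have hk := hL.cover.isKummerMap
  obtain ⟨T, hT0, hT, hinv, p, q, hpq⟩ := hk.exists_translation_invariant hL.comm h
  refine ⟨T, hT0, hT, by rw [← hinv 0, zero_add], fun a b hE φ μ hφT hμ hπ => ?_⟩
  have hE' := dual_isElliptic hE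
  obtain ⟨d, p', q', hpq'⟩ := isRationalMap_iff.mp (h.right.comp hμ.1)
  have hd : d = 2 := by
    refine hpq'.degree_eq hpq.finite_ncard_fibre_ne fun t ht => ?_
    rw [Set.mem_ofPred_eq, not_not] at ht
    rw [← ht, Set.preimage_comp]
    exact Set.ncard_preimage_of_injective_subset_range μ.injective
      (by rw [μ.surjective.range_eq]; exact Set.subset_univ _)
  subst hd
  obtain ⟨ν, hν, hV⟩ := exists_mobius_comp_isogX (a := a) (b_ne_zero hE) hpq' fun z => by
    obtain ⟨Q, rfl⟩ := xMap_surjective (a := a) (b := b) z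
    obtain ⟨P, rfl⟩ := φ.toAddEquiv.surjective Q
    simp only [Function.comp]
    rw [← xMap_add, ← hφT, ← map_add, ← hπ, ← hπ, hinv]
  have hV' : V = ν ∘ isogX a b 1 ∘ μ.symm := by
    funext z
    have := congrFun hV (μ.symm z)
    simpa using this
  -- Since `V` is surjective, `U` is determined by `U ∘ V = L`, and the dual isogeny satisfies the
  -- same relation.
  refine ⟨ν, hν, hV', ?_⟩
  funext s
  obtain ⟨z, rfl⟩ := hpq.surjective two_ne_zero s
  obtain ⟨P, rfl⟩ := hk.surjective z
  have h1 : U (V (π P)) = π (2 • P) := by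
    rw [← hL.comm, h.eq_comp]
    rfl
  rw [h1, hV']
  simp only [Function.comp]
  rw [hπ P, Equiv.symm_apply_apply, Equiv.symm_apply_apply, ← xMap_quotientIsog, ← xMap_dualIsog,
    dualIsog_quotientIsog, ← map_nsmul, hπ]

/-- The decomposition given by a point of order two. -/
lemma IsLattesDoubling.exists_decomposition (hL : IsLattesDoubling W π L) {a b : ℂ}
    [hE : (twoTorsionCurve a b).IsElliptic] (φ : CurveIso W (twoTorsionCurve a b)) (hΓ : Nat.card Γ = 2)
    (hmem : ∀ P, P ∈ Γ ↔ P = 0 ∨ φ.toAddEquiv P = pt 0 0 (by ring)) :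
    ∃ U V : OnePoint ℂ → OnePoint ℂ, IsNontrivialDecomposition L U V ∧
      IsDecompositionOfSubgroup W π L Γ U V ∧ IsLattesOfJ (dualJ a b) (V ∘ U) := by
  have hE' := dual_isElliptic hE
  have hk := hL.cover.isKummerMap
  obtain ⟨μ, hμ, hπ⟩ := hL.cover.exists_mobius φ
  have hcov := isEvenDoubleCover_comp
    (isEvenDoubleCover_xMap (a := -2 * a) (b := a ^ 2 - 4 * b)) isMobius_refl
  have hpair := isTwoIsogenyPair_of_curveIso φ (Equiv.refl _) hπ hΓ hmem
  have hd : IsDecomposition L _ _ := ⟨isRationalMap_left hE hμ isMobius_refl,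
    isRationalMap_right hE hμ isMobius_refl, hpair.eq_comp hk hL.comm⟩
  refine ⟨_, _, hpair.isNontrivialDecomposition hk hcov.isKummerMap hd,
    ⟨hd, _, hE', _, hcov, hpair⟩, _, hE', _, j_dual hE hE',
    hpair.isLattesDoubling hcov hd.left hd.right⟩

lemma IsLattesDoubling.exists_decomposition' (hL : IsLattesDoubling W π L) {a b : ℂ}
    (hE : (twoTorsionCurve a b).IsElliptic) (φ : CurveIso W (twoTorsionCurve a b)) :
    ∃ U V : OnePoint ℂ → OnePoint ℂ, IsNontrivialDecomposition L U V ∧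
      IsLattesOfJ (dualJ a b) (V ∘ U) := by
  have h2 : 2 • φ.toAddEquiv.symm (pt 0 0 (by ring)) = 0 := by
    rw [← map_nsmul, two_smul_pt_zero, map_zero]
  have h0 : φ.toAddEquiv.symm (pt 0 0 (by ring)) ≠ 0 := by
    rw [Ne, map_eq_zero_iff _ φ.toAddEquiv.symm.injective]
    exact pt_ne_zero _
  obtain ⟨U, V, h, -, h'⟩ := hL.exists_decomposition φ (card_zmultiples_of_two_nsmul h0 h2) fun P => by
    rw [mem_zmultiples_iff_of_two_nsmul h2, AddEquiv.eq_symm_apply]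
  exact ⟨U, V, h, h'⟩

end Pairs

/-! ### A Lattès map determines the `j`-invariant -/

section Invariant

/-- The `j`-invariant of `y² = (t - x) (t - y) (t - z)`. -/
def cubicJ (x y z : ℂ) : ℂ :=
  256 * (x ^ 2 + y ^ 2 + z ^ 2 - x * y - y * z - z * x) ^ 3 /
    ((x - y) ^ 2 * (y - z) ^ 2 * (z - x) ^ 2)

/-- Three distinct elements of `{u, v, w}` are a permutation of it, and the expression is symmetric.
-/
lemma cubicJ_eq_of_mem {x y z u v w : ℂ} (hxy : x ≠ y) (hyz : y ≠ z) (hzx : z ≠ x)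
    (hx : x = u ∨ x = v ∨ x = w) (hy : y = u ∨ y = v ∨ y = w) (hz : z = u ∨ z = v ∨ z = w) :
    cubicJ x y z = cubicJ u v w := by
  rcases hx with rfl | rfl | rfl <;> rcases hy with rfl | rfl | rfl <;>
    rcases hz with rfl | rfl | rfl <;> first
    | exact absurd rfl hxy
    | exact absurd rfl hyz
    | exact absurd rfl hzx
    | (unfold cubicJ; congr 1 <;> ring)

/-- Numerator and denominator depend on differences of the roots only, and both are homogeneous of
degree 6. -/
lemma cubicJ_affine {α : ℂ} (hα : α ≠ 0) (β x y z : ℂ) :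
    cubicJ (α * x + β) (α * y + β) (α * z + β) = cubicJ x y z := by
  unfold cubicJ
  conv_rhs => rw [← mul_div_mul_left _ _ (pow_ne_zero 6 hα)]
  congr 1 <;> ring

lemma j_eq_cubicJ {r s : ℂ} (h : (twoTorsionCurve (-(r + s)) (r * s)).IsElliptic) :
    (twoTorsionCurve (-(r + s)) (r * s)).j = cubicJ 0 r s := by
  rw [j_eq h, cubicJ]
  congr 1 <;> ring

/-- A Lattès map determines the `j`-invariant. -/
lemma IsLattesDoubling.j_eq {W W' : WeierstrassCurve ℂ} [W.IsElliptic] [W'.IsElliptic]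
    {π : W.toAffine.Point → OnePoint ℂ} {π' : W'.toAffine.Point → OnePoint ℂ}
    {L : OnePoint ℂ → OnePoint ℂ} (h : IsLattesDoubling W π L) (h' : IsLattesDoubling W' π' L) :
    W.j = W'.j := by
  -- The data on the right are intrinsic to `L`: the values without exactly four preimages give the
  -- images of the points of order two, and `L` maps all of these to the image of `O`.
  have key : ∀ (W : WeierstrassCurve ℂ) [W.IsElliptic] (π : W.toAffine.Point → OnePoint ℂ),
      IsLattesDoubling W π L → ∃ (r s : ℂ) (μ : OnePoint ℂ ≃ OnePoint ℂ), IsMobius μ ∧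
        r ≠ 0 ∧ s ≠ 0 ∧ r ≠ s ∧ W.j = cubicJ 0 r s ∧
        {t | (L ⁻¹' {t}).ncard ≠ 4} = μ '' {((0 : ℂ) : OnePoint ℂ), (r : OnePoint ℂ), (s : OnePoint ℂ)} ∧
        ∀ t, (L ⁻¹' {t}).ncard ≠ 4 → L t = μ OnePoint.infty := by
    intro W _ π h
    obtain ⟨T, hT0, hT⟩ := exists_order_two W
    obtain ⟨a, b, hE, φ, -, hj⟩ := exists_curveIso hT0 hT
    obtain ⟨μ, hμ, hπ⟩ := h.cover.exists_mobius φ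
    obtain ⟨r, s, rfl, rfl, hr, hs, hrs⟩ := exists_roots hE
    have hk : IsKummerMap (μ ∘ xMap (twoTorsionCurve (-(r + s)) (r * s))) :=
      (isEvenDoubleCover_comp isEvenDoubleCover_xMap hμ).isKummerMap
    have hcomm : ∀ P, L ((μ ∘ xMap (twoTorsionCurve (-(r + s)) (r * s))) P) =
        (μ ∘ xMap (twoTorsionCurve (-(r + s)) (r * s))) (2 • P) := by
      intro P
      obtain ⟨Q, rfl⟩ := φ.toAddEquiv.surjective P
      simp only [Function.comp]
      rw [← hπ, h.comm, hπ, map_nsmul]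
    have hset := hk.setOf_ncard_fibre_ne hcomm (exists_two_nsmul_eq _ _)
    refine ⟨r, s, μ, hμ, hr, hs, hrs, hj.symm.trans (j_eq_cubicJ hE), ?_, fun t ht => ?_⟩
    · rw [hset, Set.image_comp, image_xMap_torsion]
    · obtain ⟨T, hT, rfl⟩ := hset.subset ht
      rw [hcomm, hT.2]
      rfl
  obtain ⟨r, s, μ, hμ, hr, hs, hrs, hj, hset, hinf⟩ := key W π h
  obtain ⟨r', s', μ', hμ', -, -, -, hj', hset', hinf'⟩ := key W' π' h'
  -- This transformation compares the two `x`-coordinates. It fixes `∞`, hence is affine, and it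
  -- maps the roots `0, r, s` to the roots `0, r', s'`.
  obtain ⟨g, hg⟩ := (hμ.trans hμ'.symm).1.exists_smul_of_injective (μ.trans μ'.symm).injective
  have hg' : ∀ z, μ'.symm (μ z) = g • z := fun z => congrFun hg z
  have himg : ∀ z : ℂ, μ z ∈ μ '' {((0 : ℂ) : OnePoint ℂ), (r : OnePoint ℂ), (s : OnePoint ℂ)} →
      g • (z : OnePoint ℂ) ∈ ({((0 : ℂ) : OnePoint ℂ), (r' : OnePoint ℂ), (s' : OnePoint ℂ)} : Set _) := by
    intro z hz
    rw [← hset, hset'] at hz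
    obtain ⟨w, hw, hwz⟩ := hz
    rw [← hg', ← hwz, Equiv.symm_apply_apply]
    exact hw
  have hginf : g • (OnePoint.infty : OnePoint ℂ) = OnePoint.infty := by
    have h0 : (L ⁻¹' {μ (0 : ℂ)}).ncard ≠ 4 := hset.superset ⟨_, Or.inl rfl, rfl⟩
    rw [← hg', ← hinf _ h0, hinf' _ h0, Equiv.symm_apply_apply]
  rw [OnePoint.smul_infty_eq_self_iff] at hginf
  have hdet : g 0 0 * g 1 1 - g 0 1 * g 1 0 ≠ 0 := by
    have := g.det.ne_zero
    rwa [Matrix.GeneralLinearGroup.val_det_apply, Matrix.det_fin_two] at this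
  rw [hginf, mul_zero, sub_zero] at hdet
  have h11 : g 1 1 ≠ 0 := right_ne_zero_of_mul hdet
  have hα : g 0 0 / g 1 1 ≠ 0 := div_ne_zero (left_ne_zero_of_mul hdet) h11
  have hgz : ∀ z : ℂ, g • (z : OnePoint ℂ) = ((g 0 0 / g 1 1 * z + g 0 1 / g 1 1 : ℂ) : OnePoint ℂ) := by
    intro z
    rw [OnePoint.smul_some_eq_ite, hginf, zero_mul, zero_add, if_neg h11]
    congr 1
    field_simp
  have hmem : ∀ z : ℂ, z = 0 ∨ z = r ∨ z = s → g 0 0 / g 1 1 * z + g 0 1 / g 1 1 = 0 ∨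
      g 0 0 / g 1 1 * z + g 0 1 / g 1 1 = r' ∨ g 0 0 / g 1 1 * z + g 0 1 / g 1 1 = s' := by
    intro z hz
    have := himg z ⟨z, by simpa using hz, rfl⟩
    rw [hgz] at this
    simpa only [Set.mem_insert_iff, Set.mem_singleton_iff, OnePoint.coe_eq_coe] using this
  have hinj : ∀ {z w : ℂ}, z ≠ w → g 0 0 / g 1 1 * z + g 0 1 / g 1 1 ≠ g 0 0 / g 1 1 * w + g 0 1 / g 1 1 := by
    intro z w hzw e
    exact hzw (mul_left_cancel₀ hα (add_right_cancel e))
  rw [hj, hj', ← cubicJ_affine hα (g 0 1 / g 1 1)]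
  exact cubicJ_eq_of_mem (hinj hr.symm) (hinj hrs) (hinj hs) (hmem _ (Or.inl rfl))
    (hmem _ (Or.inr (Or.inl rfl))) (hmem _ (Or.inr (Or.inr rfl)))

end Invariant

/-! ### Conjugation and decompositions with an invertible factor -/

/-- Conjugates of a Lattès map are Lattès maps for the same curve. -/
lemma IsLattesDoubling.conj {W : WeierstrassCurve ℂ} {π : W.toAffine.Point → OnePoint ℂ}
    {L : OnePoint ℂ → OnePoint ℂ} (hL : IsLattesDoubling W π L) {μ : OnePoint ℂ ≃ OnePoint ℂ}
    (hμ : IsMobius μ) : IsLattesDoubling W (μ.symm ∘ π) (μ.symm ∘ L ∘ μ) := by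
  refine ⟨hμ.2.comp (hL.rational.comp hμ.1), isEvenDoubleCover_comp hL.cover hμ.symm, fun P => ?_⟩
  simp only [Function.comp]
  rw [Equiv.apply_symm_apply, hL.comm]

/-- Here `V ∘ U` is `U⁻¹ ∘ L ∘ U` if `U` is invertible, and `V ∘ L ∘ V⁻¹` if `V` is. -/
lemma IsDecomposition.exists_conj {L U V : OnePoint ℂ → OnePoint ℂ} (h : IsDecomposition L U V)
    (hUV : IsInvertibleMap U ∨ IsInvertibleMap V) :
    ∃ μ : OnePoint ℂ ≃ OnePoint ℂ, IsMobius μ ∧ V ∘ U = μ.symm ∘ L ∘ μ := by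
  rcases hUV with ⟨μ, hμ, rfl⟩ | ⟨μ, hμ, rfl⟩
  · refine ⟨μ, hμ, ?_⟩
    rw [h.eq_comp]
    funext z
    simp
  · refine ⟨μ.symm, hμ.symm, ?_⟩
    rw [h.eq_comp]
    funext z
    simp

end

/-! ### The theorem -/

theorem mainTheorem4 (j : ℂ) (W : WeierstrassCurve ℂ) [W.IsElliptic] (hj : W.j = j)
    (π : W.toAffine.Point → OnePoint ℂ) (L : OnePoint ℂ → OnePoint ℂ)
    (hL : IsLattesDoubling W π L) :
    -- trivial decompositions lead to conjugate maps, which are again of the form `𝓛_j`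
    (∀ U V : OnePoint ℂ → OnePoint ℂ, IsDecomposition L U V →
      IsInvertibleMap U ∨ IsInvertibleMap V →
        AreConjugate L (V ∘ U) ∧ IsLattesOfJ j (V ∘ U)) ∧
    -- any other decomposition comes from a 2-isogeny `W → W'`, and it leads to `𝓛_{j'}` with
    -- `j'` the invariant of `W'`, which satisfies the modular equation
    (∀ U V : OnePoint ℂ → OnePoint ℂ, IsNontrivialDecomposition L U V →
      ∃ (Γ : AddSubgroup W.toAffine.Point) (W' : WeierstrassCurve ℂ) (_ : W'.IsElliptic)
        (π' : W'.toAffine.Point → OnePoint ℂ),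
        IsTwoIsogenyPair W W' π π' Γ U V ∧
        IsLattesDoubling W' π' (V ∘ U) ∧ modularPhiTwo j W'.j = 0) ∧
    -- the values `j'` obtained from nontrivial decompositions are exactly the solutions of the
    -- modular equation
    (∀ j' : ℂ, modularPhiTwo j j' = 0 ↔
      ∃ U V : OnePoint ℂ → OnePoint ℂ,
        IsNontrivialDecomposition L U V ∧ IsLattesOfJ j' (V ∘ U)) ∧
    -- there are three subgroups of order two, each of them gives a nontrivial decomposition, and
    -- two of these decompositions are equivalent only if the subgroups are the same
    Nat.card {Γ : AddSubgroup W.toAffine.Point // Nat.card Γ = 2} = 3 ∧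
    (∀ Γ : AddSubgroup W.toAffine.Point, Nat.card Γ = 2 →
      ∃ U V : OnePoint ℂ → OnePoint ℂ,
        IsNontrivialDecomposition L U V ∧ IsDecompositionOfSubgroup W π L Γ U V) ∧
    (∀ (Γ₁ Γ₂ : AddSubgroup W.toAffine.Point) (U₁ V₁ U₂ V₂ : OnePoint ℂ → OnePoint ℂ),
      IsDecompositionOfSubgroup W π L Γ₁ U₁ V₁ → IsDecompositionOfSubgroup W π L Γ₂ U₂ V₂ →
        (AreEquivalentDecompositions U₁ V₁ U₂ V₂ ↔ Γ₁ = Γ₂)) := by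
  have hk := hL.cover.isKummerMap
  have hpart2 : ∀ U V : OnePoint ℂ → OnePoint ℂ, IsNontrivialDecomposition L U V →
      ∃ (Γ : AddSubgroup W.toAffine.Point) (W' : WeierstrassCurve ℂ) (_ : W'.IsElliptic)
        (π' : W'.toAffine.Point → OnePoint ℂ),
        IsTwoIsogenyPair W W' π π' Γ U V ∧
        IsLattesDoubling W' π' (V ∘ U) ∧ modularPhiTwo j W'.j = 0 := by
    intro U V h
    obtain ⟨T, hT0, hT, -, hstd⟩ := hL.exists_eq_isogX h
    obtain ⟨a, b, hE, φ, hφ, hjE⟩ := exists_curveIso hT0 hT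
    have hE' := twoTorsionCurve.dual_isElliptic hE
    obtain ⟨μ, hμ, hπ⟩ := hL.cover.exists_mobius φ
    obtain ⟨ν, hν, rfl, rfl⟩ := hstd a b φ μ hφ hμ hπ
    have hpair := isTwoIsogenyPair_of_curveIso (Γ := AddSubgroup.zmultiples T) φ ν hπ
      (card_zmultiples_of_two_nsmul hT0 hT) fun P => by
        rw [mem_zmultiples_iff_of_two_nsmul hT, ← hφ, φ.toAddEquiv.injective.eq_iff]
    refine ⟨_, _, hE', _, hpair, hpair.isLattesDoubling
      (isEvenDoubleCover_comp twoTorsionCurve.isEvenDoubleCover_xMap hν) h.left h.right, ?_⟩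
    rw [twoTorsionCurve.j_dual hE hE', ← hj, ← hjE]
    obtain ⟨r, s, rfl, rfl, hr, hs, hrs⟩ := twoTorsionCurve.exists_roots hE
    rw [twoTorsionCurve.modularPhiTwo_eq hE hr hs hrs]
    ring
  refine ⟨fun U V h hUV => ?_, hpart2, fun j' => ⟨fun hΦ => ?_, ?_⟩, ?_, fun Γ hΓ => ?_, ?_⟩
  · obtain ⟨μ, hμ, e⟩ := h.exists_conj hUV
    rw [e]
    exact ⟨⟨μ, hμ, rfl⟩, W, inferInstance, _, hj, hL.conj hμ⟩
  · obtain ⟨T, hT0, hT⟩ := exists_order_two W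
    obtain ⟨a, b, hE, φ, -, hjE⟩ := exists_curveIso hT0 hT
    obtain ⟨r, s, rfl, rfl, hr, hs, hrs⟩ := twoTorsionCurve.exists_roots hE
    rw [← hj, ← hjE, twoTorsionCurve.modularPhiTwo_eq hE hr hs hrs, mul_eq_zero, mul_eq_zero,
      sub_eq_zero, sub_eq_zero, sub_eq_zero] at hΦ
    -- Each root of `Φ₂(j, Y)` belongs to one point of order two; the second and third cases first
    -- move `(r, 0)` or `(s, 0)` to the origin.
    rcases hΦ with (rfl | rfl) | rfl
    · exact hL.exists_decomposition' hE φ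
    · have hs : IsShift (twoTorsionCurve (-(r + s)) (r * s))
          (twoTorsionCurve (2 * r - s) (r * (r - s))) r 0 0 := by
        constructor <;> simp only <;> ring
      have hE₁ := hs.isElliptic
      exact hL.exists_decomposition' hE₁ (φ.trans hs.curveIso)
    · have hs : IsShift (twoTorsionCurve (-(r + s)) (r * s))
          (twoTorsionCurve (2 * s - r) (s * (s - r))) s 0 0 := by
        constructor <;> simp only <;> ring
      have hE₁ := hs.isElliptic
      exact hL.exists_decomposition' hE₁ (φ.trans hs.curveIso)
  · rintro ⟨U, V, h, W'', hW'', π'', rfl, hL''⟩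
    obtain ⟨Γ, W', hW', π', -, hL', hΦ⟩ := hpart2 U V h
    -- The curve realizing `V ∘ U` as `𝓛_{j'}` need not be the quotient curve `W'`, but both induce
    -- the same map and hence have the same invariant.
    rwa [hL''.j_eq hL']
  · rw [card_addSubgroup_card_eq_two]
    have h0 : {T : W.toAffine.Point | T ≠ 0 ∧ 2 • T = 0} = {T | 2 • T = 0} \ {0} := by
      ext T
      simp [and_comm]
    rw [h0, Set.ncard_sdiff_singleton_of_mem
      (show (0 : W.toAffine.Point) ∈ {T : W.toAffine.Point | 2 • T = 0} from nsmul_zero 2), hk.ncard_torsion]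
  · obtain ⟨T, hT0, hT, hmem⟩ := AddSubgroup.exists_of_card_eq_two hΓ
    obtain ⟨a, b, hE, φ, hφ, -⟩ := exists_curveIso hT0 hT
    obtain ⟨U, V, h, h', -⟩ := hL.exists_decomposition φ hΓ fun P => by
      rw [hmem, ← hφ, φ.toAddEquiv.injective.eq_iff]
    exact ⟨U, V, h, h'⟩
  · rintro Γ₁ Γ₂ U₁ V₁ U₂ V₂ ⟨hd₁, W₁, hW₁, π₁, hπ₁, hp₁⟩ ⟨hd₂, W₂, hW₂, π₂, hπ₂, hp₂⟩
    have hk₁ := hπ₁.isKummerMap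
    have hk₂ := hπ₂.isKummerMap
    constructor
    · rintro ⟨μ, -, -, rfl⟩
      ext P
      rw [← hp₁.map_eq_map_zero_iff hk₁, ← hp₂.map_eq_map_zero_iff hk₂]
      exact μ.symm.injective.eq_iff.symm
    · rintro rfl
      -- Both decompositions are invariant under the same `T`, so they take the standard form in one
      -- common model and differ only in the Möbius transformations `ν₁` and `ν₂`.
      obtain ⟨T, hT0, hT, hmem⟩ := AddSubgroup.exists_of_card_eq_two hp₁.1
      obtain ⟨a, b, hE, φ, hφ, -⟩ := exists_curveIso hT0 hT
      obtain ⟨μ, hμ, hπ⟩ := hL.cover.exists_mobius φ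
      obtain ⟨T₁, hT₁0, -, hV₁, hstd₁⟩ :=
        hL.exists_eq_isogX (hp₁.isNontrivialDecomposition hk hk₁ hd₁)
      obtain ⟨T₂, hT₂0, -, hV₂, hstd₂⟩ :=
        hL.exists_eq_isogX (hp₂.isNontrivialDecomposition hk hk₂ hd₂)
      rw [hp₁.map_eq_map_zero_iff hk₁, hmem] at hV₁
      rw [hp₂.map_eq_map_zero_iff hk₂, hmem] at hV₂
      obtain rfl := hV₁.resolve_left hT₁0
      obtain rfl := hV₂.resolve_left hT₂0
      obtain ⟨ν₁, hν₁, rfl, rfl⟩ := hstd₁ a b φ μ hφ hμ hπ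
      obtain ⟨ν₂, hν₂, rfl, rfl⟩ := hstd₂ a b φ μ hφ hμ hπ
      refine ⟨ν₂.symm.trans ν₁, hν₂.symm.trans hν₁, ?_, ?_⟩
      · funext z
        simp
      · funext z
        simp
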